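/- Let $I\subset\{1,\dots,n\}$ and let $F_{ij}\colon\mathbb C^n\to\mathbb C$ $(i,j\in I)$ be holomorphic functions with $\partial F_{ij}/\partial z_k=0$ for all $i,j,k\in I$. Conventions. On $T\oplus T^*$ put $\langle X+\alpha,Y+\beta\rangle=\frac12(\alpha(Y)+\beta(X))$, extended complex bilinearly to $T_{\mathbb C}\oplus T_{\mathbb C}^*$, and use the Courant bracket $[X+\alpha,Y+\beta]=[X,Y]+L_X\beta-L_Y\alpha-\frac12(d\iota_X\beta-d\iota_Y\alpha)$. A generalized complex structure on an open set $U$ is a smooth orthogonal bundle map $\mathcal J$ of $TU\oplus T^*U$ with $\mathcal J^2=-1$ whose $\sqrt{-1}$-eigenbundle is closed under the Courant bracket. A generalized Kähler structure is a pair of commuting generalized complex structures $\mathcal J_1,\mathcal J_2$ such that $G=-\mathcal J_1\mathcal J_2$ satisfies $\langle Gw,w\rangle>0$ for all real $w\ne0$. Let $\omega=\frac{\sqrt{-1}}2\sum_i dz_i\wedge d\bar z_i$, let $\mathcal J_\omega(X+\alpha)=\omega^{-1}\alpha-\iota_X\omega$ (where $\omega$ also denotes the map $X\mapsto\iota_X\omega$),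 and let $L=T_{0,1}\oplus T_{1,0}^*$. For a section $\epsilon$ of $\wedge^2\overline L$ let $\iota_Y(a\wedge b)=\langle a,Y\rangle b-\langle b,Y\rangle a$, let $L_\epsilon=\{Y+\iota_Y\epsilon\mid Y\in L\}$, and let $A_\epsilon=\begin{pmatrix}1&\bar\epsilon\\ \epsilon&1\end{pmatrix}$ on $L\oplus\overline L$. (1) Let $\epsilon$ be either $$\epsilon=\sum_{i,j\in I}F_{ij}\,\partial_{z_i}\wedge\partial_{z_j}+\sum_{i,j\in I}F_{ij}\,d\bar z_i\wedge d\bar z_j$$ or $$\epsilon^\omega=\sum_{i,j\in I}F_{ij}\,\bigl(\partial_{z_i}\wedge\partial_{z_j}+\iota_{\partial_{z_i}}\omega\wedge\iota_{\partial_{z_j}}\omega\bigr).$$ Then $L_\epsilon$ is closed under the Courant bracket on $\mathbb C^n$. Consequently, on every open set $U$ on which $A_\epsilon$ is invertible, there is a generalized complex structure $\mathcal J_\epsilon$ with $\sqrt{-1}$-eigenbundle $L_\epsilon$; at each point of $U$ it is the only orthogonal real endomorphism with square $-1$ and $\sqrt{-1}$-eigenspace $L_\epsilon$. (2) If $U$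 is an open set and $\mathcal J_{\epsilon^\omega}$ is a generalized complex structure on $U$ with $\sqrt{-1}$-eigenbundle $L_{\epsilon^\omega}$, then $\mathcal J_\omega$ and $\mathcal J_{\epsilon^\omega}$ commute. If moreover $A_{t\epsilon^\omega}$ is invertible at every point of $U$ for every $t\in[0,1]$, then $(\mathcal J_\omega,\mathcal J_{\epsilon^\omega})$ is a generalized Kähler structure on $U$. (3) For every bounded open set $U$ there is $t_0>0$ such that for all $0<t\le t_0$ the endomorphism $A_{t\epsilon^\omega}$ is invertible on $U$ and $(\mathcal J_\omega,\mathcal J_{t\epsilon^\omega})$ is a generalized Kähler structure on $U$. -/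

import Mathlib

open scoped ContDiff

noncomputable section

namespace GenKahler

/-- Index set of the complex coordinate frame of `ℂⁿ`: `Sum.inl i` stands for `z_i` and `Sum.inr i`
for its conjugate coordinate. -/
abbrev Idx (n : ℕ) := Fin n ⊕ Fin n

/-- The fibre of `T_ℂ ℂⁿ ⊕ T_ℂ^* ℂⁿ`. The first component `X` is the complex tangent vector
`∑ X (inl i) ∂/∂z_i + ∑ X (inr i) ∂/∂z̄_i`, the second component `α` is the complex covector
`∑ α (inl i) dz_i + ∑ α (inr i) dz̄_i`. -/
abbrev GT (n : ℕ) := (Idx n → ℂ) × (Idx n → ℂ)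

/-- Evaluation of a complex covector on a complex tangent vector. -/
def ev {n : ℕ} (α X : Idx n → ℂ) : ℂ := ∑ A, α A * X A

/-- The natural metric `⟨X + α, Y + β⟩ = (α(Y) + β(X)) / 2`, extended complex bilinearly. -/
def pair {n : ℕ} (v w : GT n) : ℂ := (1 / 2) * (ev v.2 w.1 + ev w.2 v.1)

/-- Conjugation of vectors or covectors; it exchanges `∂/∂z_i` with `∂/∂z̄_i`, `dz_i` with `dz̄_i`. -/
def conjIdx {n : ℕ} (X : Idx n → ℂ) : Idx n → ℂ := fun A => starRingEnd ℂ (X A.swap)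

/-- Complex conjugation on `T_ℂ ⊕ T_ℂ^*`; its fixed points are the real space `T ⊕ T^*`. -/
def conjGT {n : ℕ} (w : GT n) : GT n := (conjIdx w.1, conjIdx w.2)

/-- The complex linear map `w ↦ conj (f (conj w))`. -/
def conjEnd {n : ℕ} (f : Module.End ℂ (GT n)) : Module.End ℂ (GT n) where
  toFun w := conjGT (f (conjGT w))
  map_add' v w := by
    have h : ∀ a b : GT n, conjGT (a + b) = conjGT a + conjGT b := by
      intro a b; ext A <;> simp [conjGT, conjIdx]
    rw [h, map_add, h]
  map_smul' c w := by
    have h : ∀ (c : ℂ) (a : GT n), conjGT (c • a) = (starRingEnd ℂ c) • conjGT a := by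
      intro c a; ext A <;> simp [conjGT, conjIdx]
    rw [h, map_smul, h]
    simp

/-! ### Calculus in the frame `∂/∂z_i`, `∂/∂z̄_i` -/

/-- The derivatives `∂f/∂z_i = (∂f/∂x_i - √-1 ∂f/∂y_i) / 2` and
`∂f/∂z̄_i = (∂f/∂x_i + √-1 ∂f/∂y_i) / 2`. -/
def pd {n : ℕ} (A : Idx n) (f : (Fin n → ℂ) → ℂ) (z : Fin n → ℂ) : ℂ :=
  match A with
  | Sum.inl i => (1 / 2) * (fderiv ℝ f z (Pi.single i 1) - Complex.I * fderiv ℝ f z (Pi.single i Complex.I))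
  | Sum.inr i => (1 / 2) * (fderiv ℝ f z (Pi.single i 1) + Complex.I * fderiv ℝ f z (Pi.single i Complex.I))

/-- The derivative `X f` of a function along a complex vector field. -/
def dirDeriv {n : ℕ} (X : (Fin n → ℂ) → Idx n → ℂ) (f : (Fin n → ℂ) → ℂ) (z : Fin n → ℂ) : ℂ :=
  ∑ A, X z A * pd A f z

/-- The differential `df`. -/
def dFun {n : ℕ} (f : (Fin n → ℂ) → ℂ) (z : Fin n → ℂ) : Idx n → ℂ := fun A => pd A f z

/-- The Lie bracket `[X, Y]` of complex vector fields. -/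
def lieBr {n : ℕ} (X Y : (Fin n → ℂ) → Idx n → ℂ) (z : Fin n → ℂ) : Idx n → ℂ :=
  fun A => dirDeriv X (fun p => Y p A) z - dirDeriv Y (fun p => X p A) z

/-- The Lie derivative `L_X β` of a complex one-form. -/
def lieDerivForm {n : ℕ} (X β : (Fin n → ℂ) → Idx n → ℂ) (z : Fin n → ℂ) : Idx n → ℂ :=
  fun A => dirDeriv X (fun p => β p A) z + ∑ B, β z B * pd A (fun p => X p B) z

/-- The Courant bracket
`[X + α, Y + β] = [X, Y] + L_X β - L_Y α - (d ι_X β - d ι_Y α) / 2`. -/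
def courant {n : ℕ} (s t : (Fin n → ℂ) → GT n) (z : Fin n → ℂ) : GT n :=
  (lieBr (fun p => (s p).1) (fun p => (t p).1) z,
    lieDerivForm (fun p => (s p).1) (fun p => (t p).2) z
      - lieDerivForm (fun p => (t p).1) (fun p => (s p).2) z
      - (1 / 2 : ℂ) • (dFun (fun p => ev (t p).2 (s p).1) z - dFun (fun p => ev (s p).2 (t p).1) z))

/-- A family of subspaces is closed under the Courant bracket over `U`: the bracket of two smooth
local sections, over any open subset of `U`, is a section again. -/
def CourantClosedOn {n : ℕ} (U : Set (Fin n → ℂ)) (L : (Fin n → ℂ) → Submodule ℂ (GT n)) : Prop :=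
  ∀ V : Set (Fin n → ℂ), IsOpen V → V ⊆ U → ∀ s t : (Fin n → ℂ) → GT n,
    ContDiffOn ℝ ∞ s V → ContDiffOn ℝ ∞ t V →
    (∀ z ∈ V, s z ∈ L z) → (∀ z ∈ V, t z ∈ L z) → ∀ z ∈ V, courant s t z ∈ L z

/-! ### Generalized complex and generalized Kähler structures -/

/-- The `√-1` eigenspace. -/
def eigen {n : ℕ} (J : Module.End ℂ (GT n)) : Submodule ℂ (GT n) :=
  Module.End.eigenspace J Complex.I

/-- A generalized complex structure on the tangent space of `ℂⁿ` at a point: an orthogonal real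
endomorphism of `T ⊕ T^*` with square `-1`. A real endomorphism of `T ⊕ T^*` is given by its
complexification, that is, by a complex endomorphism commuting with conjugation. -/
structure IsGenComplexVec {n : ℕ} (J : Module.End ℂ (GT n)) : Prop where
  real : ∀ w, J (conjGT w) = conjGT (J w)
  orthogonal : ∀ v w, pair (J v) (J w) = pair v w
  sq : ∀ w, J (J w) = -w

/-- A generalized complex structure on `U`: a smooth family of pointwise structures whose `√-1`
eigenbundle is closed under the Courant bracket. -/
structure IsGenComplexOn {n : ℕ} (U : Set (Fin n → ℂ)) (J : (Fin n → ℂ) → Module.End ℂ (GT n)) :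
    Prop where
  smooth : ∀ w : GT n, ContDiffOn ℝ ∞ (fun z => J z w) U
  pointwise : ∀ z ∈ U, IsGenComplexVec (J z)
  closed : CourantClosedOn U (fun z => eigen (J z))

/-- A positive definite metric on `T ⊕ T^*`. -/
structure IsPosMetric {n : ℕ} (G : Module.End ℂ (GT n)) : Prop where
  real : ∀ w, G (conjGT w) = conjGT (G w)
  sq : ∀ w, G (G w) = w
  orthogonal : ∀ v w, pair (G v) (G w) = pair v w
  pos : ∀ w, conjGT w = w → w ≠ 0 → 0 < (pair (G w) w).re

/-- A generalized Kähler structure on `U`. -/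
structure IsGenKahlerOn {n : ℕ} (U : Set (Fin n → ℂ)) (J₁ J₂ : (Fin n → ℂ) → Module.End ℂ (GT n)) :
    Prop where
  fst : IsGenComplexOn U J₁
  snd : IsGenComplexOn U J₂
  comm : ∀ z ∈ U, J₁ z * J₂ z = J₂ z * J₁ z
  metric : ∀ z ∈ U, IsPosMetric (-(J₁ z * J₂ z))

/-! ### The standard Kähler structure of `ℂⁿ` -/

/-- The map `X ↦ ι_X ω` for `ω = ∑ dx_i ∧ dy_i = (√-1 / 2) ∑ dz_i ∧ dz̄_i`. -/
def omega (n : ℕ) : (Idx n → ℂ) ≃ₗ[ℂ] (Idx n → ℂ) where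
  toFun X := Sum.elim (fun i => -(Complex.I / 2) * X (Sum.inr i)) (fun i => (Complex.I / 2) * X (Sum.inl i))
  invFun α := Sum.elim (fun i => -(2 * Complex.I) * α (Sum.inr i)) (fun i => (2 * Complex.I) * α (Sum.inl i))
  map_add' X Y := by ext (i | i) <;> simp <;> ring
  map_smul' c X := by ext (i | i) <;> simp <;> ring
  left_inv X := by
    ext (i | i) <;> simp <;> ring_nf <;> simp [Complex.I_sq]
  right_inv X := by
    ext (i | i) <;> simp <;> ring_nf <;> simp [Complex.I_sq]

/-- The structure `J_ω (X + α) = ω⁻¹ α - ι_X ω`. -/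
def Jomega (n : ℕ) : Module.End ℂ (GT n) where
  toFun w := ((omega n).symm w.2, -(omega n w.1))
  map_add' v w := by ext <;> simp; ring
  map_smul' c w := by ext <;> simp

/-- The structure `J_J (X + α) = -J X + J^* α`, with `J` the complex structure of `ℂⁿ`
(`J ∂/∂z_i = √-1 ∂/∂z_i`, `J ∂/∂z̄_i = -√-1 ∂/∂z̄_i`). -/
def Jcplx (n : ℕ) : Module.End ℂ (GT n) where
  toFun w := (Sum.elim (fun i => -Complex.I * w.1 (Sum.inl i)) (fun i => Complex.I * w.1 (Sum.inr i)),
    Sum.elim (fun i => Complex.I * w.2 (Sum.inl i)) (fun i => -Complex.I * w.2 (Sum.inr i)))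
  map_add' v w := by ext (i | i) <;> simp <;> ring
  map_smul' c w := by ext (i | i) <;> simp <;> ring

/-- `L = T_{0,1} ⊕ T_{1,0}^*`, the `√-1` eigenspace of `J_J`. -/
def LJ (n : ℕ) : Submodule ℂ (GT n) := eigen (Jcplx n)

/-! ### Deformations -/

/-- The two-vector `a ∧ b` on `T_ℂ ⊕ T_ℂ^*`, given by its contraction
`ι_Y (a ∧ b) = ⟨a, Y⟩ b - ⟨b, Y⟩ a`. -/
def wedge {n : ℕ} (a b : GT n) : Module.End ℂ (GT n) where
  toFun Y := pair a Y • b - pair b Y • a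
  map_add' v w := by
    have h : ∀ a : GT n, pair a (v + w) = pair a v + pair a w := by
      intro a
      simp only [pair, ev, Prod.fst_add, Prod.snd_add, Pi.add_apply, mul_add, add_mul,
        Finset.sum_add_distrib]
      ring
    rw [h, h, add_smul, add_smul]; abel
  map_smul' c w := by
    have h : ∀ a : GT n, pair a (c • w) = c * pair a w := by
      intro a
      simp only [pair, ev, Prod.smul_fst, Prod.smul_snd, Pi.smul_apply, smul_eq_mul, mul_add,
        Finset.mul_sum]
      congr 1 <;> exact Finset.sum_congr rfl fun _ _ => by ring
    rw [h, h, mul_smul, mul_smul, RingHom.id_apply, smul_sub]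

/-- The vector `∂/∂z_i`. -/
def dZ {n : ℕ} (i : Fin n) : GT n := (Pi.single (Sum.inl i) 1, 0)

/-- The covector `dz̄_i`. -/
def dzbar {n : ℕ} (i : Fin n) : GT n := (0, Pi.single (Sum.inr i) 1)

/-- The covector `ι_{∂/∂z_i} ω`. -/
def iotaOmega {n : ℕ} (i : Fin n) : GT n := (0, omega n (dZ i).1)

/-- `ε = ∑_{i,j ∈ I} F_{ij} ∂/∂z_i ∧ ∂/∂z_j + ∑_{i,j ∈ I} F_{ij} dz̄_i ∧ dz̄_j`. -/
def epsStd {n : ℕ} (I : Finset (Fin n)) (F : Fin n → Fin n → (Fin n → ℂ) → ℂ) (z : Fin n → ℂ) :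
    Module.End ℂ (GT n) :=
  ∑ i ∈ I, ∑ j ∈ I, F i j z • wedge (dZ i) (dZ j)
    + ∑ i ∈ I, ∑ j ∈ I, F i j z • wedge (dzbar i) (dzbar j)

/-- `ε = ∑_{i,j ∈ I} F_{ij} (∂/∂z_i ∧ ∂/∂z_j + ι_{∂/∂z_i} ω ∧ ι_{∂/∂z_j} ω)`. -/
def epsOmega {n : ℕ} (I : Finset (Fin n)) (F : Fin n → Fin n → (Fin n → ℂ) → ℂ) (z : Fin n → ℂ) :
    Module.End ℂ (GT n) :=
  ∑ i ∈ I, ∑ j ∈ I, F i j z • wedge (dZ i) (dZ j)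
    + ∑ i ∈ I, ∑ j ∈ I, F i j z • wedge (iotaOmega i) (iotaOmega j)

/-- `L_ε = {Y + ι_Y ε | Y ∈ L}`. -/
def deformed {n : ℕ} (ε : (Fin n → ℂ) → Module.End ℂ (GT n)) (z : Fin n → ℂ) : Submodule ℂ (GT n) :=
  (LJ n).map (1 + ε z)

/-- The endomorphism `A_ε` of `L ⊕ L̄ = T_ℂ ⊕ T_ℂ^*` with block matrix `(1, ε̄; ε, 1)`. Here `ε` is a
section of `∧² L̄`, so it maps `L` to `L̄` and kills the isotropic space `L̄`, and `ε̄` maps `L̄` to `L`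
and kills `L`. -/
def Aop {n : ℕ} (ε : Module.End ℂ (GT n)) : Module.End ℂ (GT n) := 1 + ε + conjEnd ε

/-- `J` is a generalized complex structure on `U` with `√-1` eigenbundle `L_ε`. -/
def IsDeformationOn {n : ℕ} (U : Set (Fin n → ℂ)) (ε J : (Fin n → ℂ) → Module.End ℂ (GT n)) : Prop :=
  IsGenComplexOn U J ∧ ∀ z ∈ U, eigen (J z) = deformed ε z

end GenKahler

end

/-!
An element `ε` of `∧² L̄` is an endomorphism that is skew for the natural metric, takes values in
`L̄` and vanishes on `L̄` (`IsBivector`). Hence `ε² = 0`, the space `L_ε` is isotropic, and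
`N = ε + ε̄` is skew and anticommutes with `J_J`. So where `A_ε = 1 + N` is invertible,
`A_ε J_J A_ε⁻¹` (`Jdef`) is a real orthogonal endomorphism with square `-1` whose `√-1` eigenspace
is `L_ε`. It is the only one, because an eigenspace and its conjugate span the fibre
(`IsGenComplexVec.ext_of_eqOn_eigen`).

*Closedness.* For orthogonal sections the Courant bracket is
`∇_s t - ∇_t s + 2 ∑ ⟨∂_A s, t⟩ dz_A`, with `∇` the flat derivative along vector parts
(`courant_eq_of_isotropic`). A section of `L_ε` has the form `(1 + ε) σ` with `σ` in `L`, so that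
`∂_A s` is a section of `L_ε` up to `(∂_A ε) σ`. As the `F_{ij}` are holomorphic and independent
of the `z_k`, `k ∈ I`, this error vanishes unless `A` is some `z_k` with `k ∉ I`. Sections of
`L_ε` have no component along such `∂/∂z_k`, so the first two terms lie in `L_ε`; the last one is
a combination of those `dz_k`, which lie in `L_ε` since `ε` vanishes on them
(`courantClosedOn_deformed`).

*Compatibility.* `J_ω` exchanges, up to sign, `∂/∂z_i` and `ι_{∂/∂z_i} ω`, so it commutes with
`ε^ω` (`Jomega_wedge_add`) and preserves `L_{ε^ω}`; therefore it commutes with every structure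
whose eigenspace is `L_{ε^ω}`.

*Positivity.* Put `G = -J_ω J_J`. With `w = A_ε u` one finds
`⟨-J_ω J_ε w, w⟩ = ⟨G u, u⟩ - ⟨G N u, N u⟩`, and `N` is symmetric for the positive definite
Hermitian form `⟨G v, ū⟩` (`IsBivector.inner_add_conjEnd`). The eigenvalues of `N` are real and,
as `N` anticommutes with `J_J`, symmetric about `0`. Invertibility of `1 + tN` for `0 ≤ t ≤ 1`
excludes eigenvalues in `(-∞, -1]`, so `N` is a strict contraction
(`IsBivector.norm_add_conjEnd_lt`) and the metric is positive. On a bounded set `N` is bounded in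
norm, so `1 + tN` is invertible for small `t`.

Smoothness of the family `J_ε` needs that a complex differentiable function of several variables
is smooth (`Differentiable.contDiff_of_finiteDimensional`), which follows from Cauchy's formula on
complex lines.
-/

noncomputable section

/-! ### Smoothness of holomorphic functions of several variables -/

section Hol
open Metric Set Filter Topology

variable {E : Type*} [NormedAddCommGroup E] [NormedSpace ℂ E]

theorem Differentiable.hasDerivAt_line {f : E → ℂ} (hf : Differentiable ℂ f) (z v : E) (c : ℂ) :
    HasDerivAt (fun c : ℂ => f (z + c • v)) (fderiv ℂ f (z + c • v) v) c := by
  have h1 : HasDerivAt (fun c : ℂ => z + c • v) v c := by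
    simpa using ((hasDerivAt_id c).smul_const v).const_add z
  exact (hf _).hasFDerivAt.comp_hasDerivAt c h1

/-- Cauchy's formula on complex lines expresses the derivative through the values. -/
theorem Differentiable.fderiv_apply_eq_integral {f : E → ℂ} (hf : Differentiable ℂ f) (z v : E) :
    fderiv ℂ f z v = (2 * Real.pi * Complex.I : ℂ)⁻¹ *
      ∮ c in C(0, 1), (1 / c ^ 2) • f (z + c • v) := by
  have h := (show Differentiable ℂ fun c : ℂ => f (z + c • v) from
    fun c => (hf.hasDerivAt_line z v c).differentiableAt).differentiableOn
      |>.deriv_eq_smul_circleIntegral (c := (0 : ℂ)) (R := 1) one_pos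
  rw [(hf.hasDerivAt_line z v 0).deriv] at h
  simp only [sub_zero, zero_smul, add_zero] at h
  rw [h, smul_eq_mul, inv_mul_cancel_left₀ Complex.two_pi_I_ne_zero]

/-- The derivative is locally bounded, by Cauchy's estimate on complex lines. -/
theorem Differentiable.norm_fderiv_le [ProperSpace E] {f : E → ℂ} (hf : Differentiable ℂ f)
    (z₀ : E) (r : ℝ) : ∃ C, ∀ z ∈ closedBall z₀ r, ‖fderiv ℂ f z‖ ≤ C := by
  obtain ⟨C, hC⟩ := (isCompact_closedBall z₀ (r + 1)).exists_bound_of_continuousOn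
    hf.continuous.continuousOn
  refine ⟨max C 0, fun z hz =>
    ContinuousLinearMap.opNorm_le_of_unit_norm (le_max_right _ _) fun v hv => ?_⟩
  rw [← show _root_.deriv (fun c : ℂ => f (z + c • v)) 0 = fderiv ℂ f z v by
    simpa using (hf.hasDerivAt_line z v 0).deriv, ← div_one (max C 0)]
  refine Complex.norm_deriv_le_of_forall_mem_sphere_norm_le one_pos
    (Differentiable.diffContOnCl fun c => (hf.hasDerivAt_line z v c).differentiableAt)
    fun c hc => (hC _ ?_).trans (le_max_left _ _)
  rw [mem_closedBall, dist_eq_norm] at hz ⊢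
  rw [mem_sphere_zero_iff_norm] at hc
  calc ‖z + c • v - z₀‖ = ‖(z - z₀) + c • v‖ := by congr 1; abel
    _ ≤ ‖z - z₀‖ + ‖c • v‖ := norm_add_le _ _
    _ ≤ r + 1 := by rw [norm_smul, hc, hv, one_mul]; gcongr

/-- Differentiation under the integral sign in Cauchy's formula, with the local bound on the
derivative as dominating function. -/
theorem Differentiable.differentiable_fderiv_apply [FiniteDimensional ℂ E] {f : E → ℂ}
    (hf : Differentiable ℂ f) (v : E) : Differentiable ℂ fun z => fderiv ℂ f z v := by
  have : ProperSpace E := FiniteDimensional.proper ℂ E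
  let _ : MeasurableSpace E := borel E
  have : BorelSpace E := ⟨rfl⟩
  intro z₀
  obtain ⟨C, hC⟩ := hf.norm_fderiv_le z₀ (1 + ‖v‖)
  simp only [hf.fderiv_apply_eq_integral _ v, circleIntegral]
  refine DifferentiableAt.const_mul ?_ _
  have hcm : ∀ z, Continuous fun θ : ℝ => z + circleMap 0 1 θ • v := fun z => by fun_prop
  have hne : ∀ θ, circleMap 0 1 θ ≠ 0 := fun θ => circleMap_ne_center one_ne_zero
  have hw : Continuous fun θ : ℝ => _root_.deriv (circleMap 0 1) θ * (1 / circleMap 0 1 θ ^ 2) := by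
    simp only [deriv_circleMap]
    exact Continuous.mul (by fun_prop)
      (continuous_const.div (by fun_prop) fun θ => pow_ne_zero _ (hne θ))
  refine (intervalIntegral.hasFDerivAt_integral_of_dominated_of_fderiv_le
    (F := fun z θ => _root_.deriv (circleMap 0 1) θ • (1 / circleMap 0 1 θ ^ 2) •
      f (z + circleMap 0 1 θ • v))
    (F' := fun z θ => (_root_.deriv (circleMap 0 1) θ * (1 / circleMap 0 1 θ ^ 2)) •
      fderiv ℂ f (z + circleMap 0 1 θ • v)) (bound := fun _ => C)
    (ball_mem_nhds z₀ one_pos) ?_ ?_ ?_ ?_ ?_ ?_).differentiableAt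
  · refine Eventually.of_forall fun z => Continuous.aestronglyMeasurable ?_
    simp only [smul_eq_mul, ← mul_assoc]
    exact hw.mul (hf.continuous.comp (hcm z))
  · refine Continuous.intervalIntegrable ?_ _ _
    simp only [smul_eq_mul, ← mul_assoc]
    exact hw.mul (hf.continuous.comp (hcm z₀))
  · refine MeasureTheory.AEStronglyMeasurable.smul hw.aestronglyMeasurable ?_
    exact ((measurable_fderiv ℂ f).comp (hcm z₀).measurable).aestronglyMeasurable
  · refine Eventually.of_forall fun θ _ z hz => ?_
    rw [norm_smul]
    have h1 : ‖_root_.deriv (circleMap 0 1) θ * (1 / circleMap 0 1 θ ^ 2)‖ = 1 := by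
      simp [deriv_circleMap, norm_circleMap_zero]
    rw [h1, one_mul]
    refine hC _ ?_
    rw [mem_closedBall, dist_eq_norm]
    rw [mem_ball, dist_eq_norm] at hz
    calc ‖z + circleMap 0 1 θ • v - z₀‖ = ‖(z - z₀) + circleMap 0 1 θ • v‖ := by congr 1; abel
      _ ≤ ‖z - z₀‖ + ‖circleMap 0 1 θ • v‖ := norm_add_le _ _
      _ ≤ 1 + ‖v‖ := by
        rw [norm_smul, norm_circleMap_zero, abs_one, one_mul]; gcongr
  · exact continuous_const.intervalIntegrable _ _
  · refine Eventually.of_forall fun θ _ z _ => ?_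
    simp only [smul_eq_mul, ← mul_assoc]
    have h := (hf (z + circleMap 0 1 θ • v)).hasFDerivAt.comp z
      ((hasFDerivAt_id z).add_const (circleMap 0 1 θ • v))
    exact h.const_mul _

/-- A function of several complex variables that is complex differentiable is smooth. -/
theorem Differentiable.contDiff_of_finiteDimensional [FiniteDimensional ℂ E] {f : E → ℂ}
    (hf : Differentiable ℂ f) : ContDiff ℂ ∞ f := by
  rw [contDiff_infty]
  intro m
  induction m generalizing f with
  | zero => exact contDiff_zero.2 hf.continuous
  | succ m ih =>
    push_cast
    exact contDiff_succ_iff_fderiv_apply.2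
      ⟨hf, fun h => absurd h (by simp), fun v => ih (hf.differentiable_fderiv_apply v)⟩
end Hol

/-! ### Symmetric operators -/

/-- A symmetric operator whose eigenvalues have absolute value less than one is a strict
contraction. -/
theorem LinearMap.IsSymmetric.norm_apply_lt {E : Type*} [NormedAddCommGroup E]
    [InnerProductSpace ℂ E] [FiniteDimensional ℂ E] {T : E →ₗ[ℂ] E} (hT : T.IsSymmetric)
    (h : ∀ r : ℝ, ∀ v ≠ 0, T v = (r : ℂ) • v → |r| < 1) {x : E} (hx : x ≠ 0) : ‖T x‖ < ‖x‖ := by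
  set b := hT.eigenvectorBasis rfl
  have hl : ∀ i, |hT.eigenvalues rfl i| < 1 := fun i =>
    h _ (b i) (b.orthonormal.ne_zero i) (hT.apply_eigenvectorBasis rfl i)
  have hi : ∀ i, ‖inner ℂ (b i) (T x)‖ ^ 2 =
      |hT.eigenvalues rfl i| ^ 2 * ‖inner ℂ (b i) x‖ ^ 2 := by
    intro i
    have := hT.eigenvectorBasis_apply_self_apply rfl x i
    rw [OrthonormalBasis.repr_apply_apply, OrthonormalBasis.repr_apply_apply] at this
    rw [this, norm_mul, mul_pow, RCLike.norm_ofReal]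
  obtain ⟨i, hne⟩ : ∃ i, inner ℂ (b i) x ≠ 0 := by
    by_contra! h0
    refine hx (norm_eq_zero.1 (pow_eq_zero_iff two_ne_zero |>.1 ?_))
    rw [← b.sum_sq_norm_inner_right x]
    simp [h0]
  refine lt_of_pow_lt_pow_left₀ 2 (norm_nonneg _) ?_
  rw [← b.sum_sq_norm_inner_right x, ← b.sum_sq_norm_inner_right (T x)]
  refine Finset.sum_lt_sum (fun j _ => ?_) ⟨i, Finset.mem_univ _, ?_⟩
  · rw [hi]
    exact mul_le_of_le_one_left (sq_nonneg _) (pow_le_one₀ (abs_nonneg _) (hl j).le)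
  · rw [hi]
    exact mul_lt_of_lt_one_left (by positivity) (pow_lt_one₀ (abs_nonneg _) (hl i) two_ne_zero)

namespace GenKahler
open Filter Topology
variable {n : ℕ}

/-! ### The natural metric and conjugation -/

theorem pair_comm (v w : GT n) : pair v w = pair w v := by
  simp only [pair, add_comm]

/-- The natural metric as a bilinear form. -/
def pairB (n : ℕ) : GT n →ₗ[ℂ] GT n →ₗ[ℂ] ℂ :=
  LinearMap.mk₂ ℂ pair
    (fun u v w => by
      simp only [pair, ev, Prod.fst_add, Prod.snd_add, Pi.add_apply, add_mul, mul_add,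
        Finset.sum_add_distrib]
      ring)
    (fun c v w => by
      simp only [pair, ev, Prod.smul_fst, Prod.smul_snd, Pi.smul_apply, smul_eq_mul, mul_add,
        Finset.mul_sum]
      congr 1 <;> exact Finset.sum_congr rfl fun _ _ => by ring)
    (fun u v w => by
      simp only [pair, ev, Prod.fst_add, Prod.snd_add, Pi.add_apply, add_mul, mul_add,
        Finset.sum_add_distrib]
      ring)
    (fun c v w => by
      simp only [pair, ev, Prod.smul_fst, Prod.smul_snd, Pi.smul_apply, smul_eq_mul, mul_add,
        Finset.mul_sum]
      congr 1 <;> exact Finset.sum_congr rfl fun _ _ => by ring)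

theorem pair_add_left (u v w : GT n) : pair (u + v) w = pair u w + pair v w :=
  (pairB n).map_add₂ u v w
theorem pair_add_right (u v w : GT n) : pair u (v + w) = pair u v + pair u w :=
  (pairB n u).map_add v w
theorem pair_sub_left (u v w : GT n) : pair (u - v) w = pair u w - pair v w :=
  (pairB n).map_sub₂ u v w
theorem pair_smul_left (c : ℂ) (v w : GT n) : pair (c • v) w = c * pair v w :=
  (pairB n).map_smul₂ c v w
theorem pair_smul_right (c : ℂ) (v w : GT n) : pair v (c • w) = c * pair v w :=
  (pairB n v).map_smul c w
theorem pair_neg_left (v w : GT n) : pair (-v) w = -pair v w :=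
  (pairB n).map_neg₂ v w
theorem pair_neg_right (v w : GT n) : pair v (-w) = -pair v w :=
  (pairB n v).map_neg w
theorem pair_zero_left (w : GT n) : pair 0 w = 0 :=
  (pairB n).map_zero₂ w
theorem pair_zero_right (v : GT n) : pair v 0 = 0 :=
  (pairB n v).map_zero

theorem conjGT_conjGT (w : GT n) : conjGT (conjGT w) = w := by
  ext A <;> simp [conjGT, conjIdx]

theorem conjGT_add (v w : GT n) : conjGT (v + w) = conjGT v + conjGT w := by
  ext A <;> simp [conjGT, conjIdx]

theorem conjGT_sub (v w : GT n) : conjGT (v - w) = conjGT v - conjGT w := by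
  ext A <;> simp [conjGT, conjIdx]

theorem conjGT_neg (v : GT n) : conjGT (-v) = -conjGT v := by
  ext A <;> simp [conjGT, conjIdx]

theorem conjGT_smul (c : ℂ) (w : GT n) : conjGT (c • w) = (starRingEnd ℂ c) • conjGT w := by
  ext A <;> simp [conjGT, conjIdx]

theorem pair_conjGT (v w : GT n) : pair (conjGT v) (conjGT w) = starRingEnd ℂ (pair v w) := by
  have h : ∀ α X : Idx n → ℂ, ev (conjIdx α) (conjIdx X) = starRingEnd ℂ (ev α X) := by
    intro α X
    simp only [ev, conjIdx, map_sum, map_mul]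
    exact Fintype.sum_equiv (Equiv.sumComm _ _) _ _ fun A => rfl
  simp only [pair, conjGT, h, map_mul, map_add, map_div₀, map_one, map_ofNat]

theorem conjEnd_apply (f : Module.End ℂ (GT n)) (w : GT n) :
    conjEnd f w = conjGT (f (conjGT w)) := rfl

theorem Aop_apply (e : Module.End ℂ (GT n)) (w : GT n) : Aop e w = w + (e w + conjEnd e w) := by
  simp [Aop, add_assoc]

theorem Aop_real (e : Module.End ℂ (GT n)) (w : GT n) : Aop e (conjGT w) = conjGT (Aop e w) := by
  simp only [Aop_apply, conjEnd_apply, conjGT_add, conjGT_conjGT]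
  abel

theorem Aop_ofReal_smul (t : ℝ) (e : Module.End ℂ (GT n)) :
    Aop ((t : ℂ) • e) = 1 + (t : ℂ) • (e + conjEnd e) := by
  refine LinearMap.ext fun w => ?_
  simp only [Aop_apply, conjEnd_apply, LinearMap.smul_apply, LinearMap.add_apply,
    Module.End.one_apply, conjGT_smul, Complex.conj_ofReal, smul_add]

/-! ### Generalized complex structures at a point -/

theorem mem_eigen {J : Module.End ℂ (GT n)} {w : GT n} : w ∈ eigen J ↔ J w = Complex.I • w :=
  Module.End.mem_eigenspace_iff

namespace IsGenComplexVec
variable {J J' K : Module.End ℂ (GT n)}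

theorem pair_map_left (hJ : IsGenComplexVec J) (v w : GT n) : pair (J v) w = -pair v (J w) := by
  rw [← hJ.orthogonal v (J w), hJ.sq, pair_neg_right, neg_neg]

theorem sub_mem_eigen (hJ : IsGenComplexVec J) (w : GT n) : w - Complex.I • J w ∈ eigen J := by
  rw [mem_eigen, map_sub, map_smul, hJ.sq, smul_sub, smul_smul, Complex.I_mul_I]
  module

/-- Two endomorphisms commuting with conjugation are equal if they agree on the `√-1` eigenspace of
a pointwise generalized complex structure: that space and its conjugate span. -/
theorem ext_of_eqOn_eigen (hJ : IsGenComplexVec J) {f g : Module.End ℂ (GT n)}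
    (hf : ∀ w, f (conjGT w) = conjGT (f w)) (hg : ∀ w, g (conjGT w) = conjGT (g w))
    (h : ∀ w ∈ eigen J, f w = g w) : f = g := by
  refine LinearMap.ext fun w => ?_
  have h1 := h _ (hJ.sub_mem_eigen w)
  have h2 := congrArg conjGT (h _ (hJ.sub_mem_eigen (conjGT w)))
  rw [← hf, ← hg, conjGT_sub, conjGT_smul, hJ.real, conjGT_conjGT, conjGT_conjGT,
    Complex.conj_I] at h2
  have h3 : (2 : ℂ) • w = (w - Complex.I • J w) + (w - -Complex.I • J w) := by module
  have h4 : f ((2 : ℂ) • w) = g ((2 : ℂ) • w) := by rw [h3, map_add, map_add, h1, h2]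
  rw [map_smul, map_smul] at h4
  exact smul_right_injective _ two_ne_zero h4

theorem eq_of_eigen_eq (hJ : IsGenComplexVec J) (hJ' : IsGenComplexVec J')
    (h : eigen J = eigen J') : J = J' :=
  hJ.ext_of_eqOn_eigen hJ.real hJ'.real fun w hw => by
    rw [mem_eigen.1 hw, mem_eigen.1 (h ▸ hw)]

/-- A real endomorphism that preserves the `√-1` eigenspace of `J` commutes with `J`. -/
theorem commute_of_mapsTo_eigen (hJ : IsGenComplexVec J) (hK : ∀ w, K (conjGT w) = conjGT (K w))
    (h : ∀ w ∈ eigen J, K w ∈ eigen J) : K * J = J * K :=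
  hJ.ext_of_eqOn_eigen (fun w => by simp [hJ.real, hK]) (fun w => by simp [hJ.real, hK])
    fun w hw => by simp [mem_eigen.1 hw, mem_eigen.1 (h w hw)]

theorem eigen_isotropic (hJ : IsGenComplexVec J) {v w : GT n} (hv : v ∈ eigen J)
    (hw : w ∈ eigen J) : pair v w = 0 := by
  have h := hJ.orthogonal v w
  rw [mem_eigen.1 hv, mem_eigen.1 hw, pair_smul_left, pair_smul_right, ← mul_assoc,
    Complex.I_mul_I] at h
  linear_combination (-1 / 2 : ℂ) * h

end IsGenComplexVec

theorem isGenComplexVec_Jcplx : IsGenComplexVec (Jcplx n) where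
  real w := by ext (i | i) <;> simp [Jcplx, conjGT, conjIdx]
  orthogonal v w := by
    simp only [pair, ev, Jcplx, LinearMap.coe_mk, AddHom.coe_mk, Fintype.sum_sum_type, Sum.elim_inl,
      Sum.elim_inr]
    have h : ∀ a b : ℂ, Complex.I * a * (-Complex.I * b) = a * b := fun a b => by
      linear_combination (-(a * b)) * Complex.I_sq
    have h' : ∀ a b : ℂ, -Complex.I * a * (Complex.I * b) = a * b := fun a b => by
      linear_combination (-(a * b)) * Complex.I_sq
    simp only [h, h']
  sq w := by ext (i | i) <;> simp [Jcplx, ← mul_assoc]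

theorem isGenComplexVec_Jomega : IsGenComplexVec (Jomega n) where
  real w := by
    ext (i | i) <;> simp [Jomega, omega, conjGT, conjIdx, Complex.conj_ofNat, neg_div]
  orthogonal v w := by
    have h : ∀ α X : Idx n → ℂ, ev (-(omega n X)) ((omega n).symm α) = ev α X := by
      intro α X
      simp only [ev, Fintype.sum_sum_type, omega, Pi.neg_apply, LinearEquiv.coe_mk,
        LinearMap.coe_mk, AddHom.coe_mk, LinearEquiv.coe_symm_mk, Sum.elim_inl, Sum.elim_inr]
      rw [add_comm]
      congr 1 <;> refine Finset.sum_congr rfl fun i _ => ?_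
      · linear_combination (-(α (Sum.inl i) * X (Sum.inl i))) * Complex.I_sq
      · linear_combination (-(α (Sum.inr i) * X (Sum.inr i))) * Complex.I_sq
    simp only [pair, Jomega, LinearMap.coe_mk, AddHom.coe_mk, h, add_comm]
  sq w := by ext (i | i) <;> simp [Jomega]

theorem Jomega_mul_Jcplx : Jomega n * Jcplx n = Jcplx n * Jomega n := by
  refine LinearMap.ext fun w => ?_
  ext (i | i) <;> simp [Jomega, Jcplx, omega] <;> ring

/-! ### Deformations at a point -/

/-- The condition that an endomorphism is the contraction with an element of `∧² L̄`: it is skew,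
takes values in the `-√-1` eigenspace `L̄` of `J_J`, and vanishes on `L̄`. -/
structure IsBivector (e : Module.End ℂ (GT n)) : Prop where
  skew : ∀ v w, pair (e v) w = -pair v (e w)
  left : ∀ w, Jcplx n (e w) = -(Complex.I • e w)
  right : ∀ w, e (Jcplx n w) = Complex.I • e w

namespace IsBivector
variable {e f : Module.End ℂ (GT n)}

theorem zero : IsBivector (0 : Module.End ℂ (GT n)) where
  skew v w := by simp [pair_zero_left, pair_zero_right]
  left w := by simp
  right w := by simp

theorem add (he : IsBivector e) (hf : IsBivector f) : IsBivector (e + f) where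
  skew v w := by
    simp only [LinearMap.add_apply, pair_add_left, pair_add_right, he.skew, hf.skew]; ring
  left w := by simp only [LinearMap.add_apply, map_add, he.left, hf.left]; module
  right w := by simp only [LinearMap.add_apply, he.right, hf.right]; module

theorem smul (he : IsBivector e) (c : ℂ) : IsBivector (c • e) where
  skew v w := by simp only [LinearMap.smul_apply, pair_smul_left, pair_smul_right, he.skew]; ring
  left w := by simp only [LinearMap.smul_apply, map_smul, he.left]; module
  right w := by simp only [LinearMap.smul_apply, he.right]; module

theorem sum {ι : Type*} {s : Finset ι} {g : ι → Module.End ℂ (GT n)}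
    (h : ∀ i ∈ s, IsBivector (g i)) : IsBivector (∑ i ∈ s, g i) :=
  Finset.sum_induction g IsBivector (fun _ _ => add) zero h

/-- `ε² = 0`, since `ε` maps to `L̄`, on which it vanishes. -/
theorem sq_eq_zero (he : IsBivector e) (w : GT n) : e (e w) = 0 := by
  have h := he.right (e w)
  rw [he.left, map_neg, map_smul] at h
  simpa [Complex.I_ne_zero] using neg_eq_self.1 h

theorem conjEnd_skew (he : IsBivector e) (v w : GT n) :
    pair (conjEnd e v) w = -pair v (conjEnd e w) := by
  rw [← conjGT_conjGT w, conjEnd_apply, pair_conjGT, he.skew, map_neg, ← pair_conjGT,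
    conjGT_conjGT, conjEnd_apply, conjGT_conjGT]

theorem conjEnd_left (he : IsBivector e) (w : GT n) :
    Jcplx n (conjEnd e w) = Complex.I • conjEnd e w := by
  rw [conjEnd_apply, isGenComplexVec_Jcplx.real, he.left, conjGT_neg, conjGT_smul]
  simp

theorem conjEnd_right (he : IsBivector e) (w : GT n) :
    conjEnd e (Jcplx n w) = -(Complex.I • conjEnd e w) := by
  rw [conjEnd_apply, ← isGenComplexVec_Jcplx.real, he.right, conjGT_smul, conjEnd_apply]
  simp

/-- `ε̄` vanishes on `L`. -/
theorem conjEnd_eq_zero (he : IsBivector e) {w : GT n} (hw : w ∈ LJ n) : conjEnd e w = 0 := by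
  have h := he.conjEnd_right w
  rw [mem_eigen.1 hw, map_smul] at h
  simpa [Complex.I_ne_zero] using self_eq_neg.1 h

theorem add_conjEnd_skew (he : IsBivector e) (v w : GT n) :
    pair ((e + conjEnd e) v) w = -pair v ((e + conjEnd e) w) := by
  simp only [LinearMap.add_apply, pair_add_left, pair_add_right, he.skew, he.conjEnd_skew]
  ring

/-- `ε + ε̄` exchanges `L` and `L̄`. -/
theorem add_conjEnd_Jcplx (he : IsBivector e) (w : GT n) :
    (e + conjEnd e) (Jcplx n w) = -Jcplx n ((e + conjEnd e) w) := by
  simp only [LinearMap.add_apply, map_add, he.left, he.right, he.conjEnd_left, he.conjEnd_right]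
  module

theorem Aop_eq (he : IsBivector e) {w : GT n} (hw : w ∈ LJ n) : Aop e w = (1 + e) w := by
  simp [Aop_apply, he.conjEnd_eq_zero hw]

/-- `A_ε^* A_ε = 1 - (ε + ε̄)²` for the natural metric. -/
theorem pair_Aop (he : IsBivector e) (v w : GT n) :
    pair (Aop e v) (Aop e w) = pair v w - pair ((e + conjEnd e) ((e + conjEnd e) v)) w := by
  have h : ∀ w, Aop e w = w + (e + conjEnd e) w := fun w => Aop_apply e w
  rw [h, h, pair_add_left, pair_add_right, pair_add_right, he.add_conjEnd_skew v w,
    he.add_conjEnd_skew _ w]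
  ring

theorem deformed_isotropic (he : IsBivector e) {v w : GT n} (hv : v ∈ (LJ n).map (1 + e))
    (hw : w ∈ (LJ n).map (1 + e)) : pair v w = 0 := by
  obtain ⟨a, ha, rfl⟩ := hv
  obtain ⟨b, hb, rfl⟩ := hw
  simp only [LinearMap.add_apply, Module.End.one_apply, pair_add_left, pair_add_right,
    isGenComplexVec_Jcplx.eigen_isotropic ha hb, he.skew a, he.sq_eq_zero, pair_zero_right]
  ring

end IsBivector

/-- The structure `A_ε J_J A_ε⁻¹` with `√-1` eigenspace `L_ε`. Where `A_ε` is not invertible the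
inverse is `0`. -/
def Jdef (e : Module.End ℂ (GT n)) : Module.End ℂ (GT n) :=
  Aop e * Jcplx n * Ring.inverse (Aop e)

theorem Aop_inverse_apply {e : Module.End ℂ (GT n)} (hu : IsUnit (Aop e)) (w : GT n) :
    Aop e (Ring.inverse (Aop e) w) = w :=
  LinearMap.congr_fun (Ring.mul_inverse_cancel _ hu) w

theorem inverse_Aop_apply {e : Module.End ℂ (GT n)} (hu : IsUnit (Aop e)) (w : GT n) :
    Ring.inverse (Aop e) (Aop e w) = w :=
  LinearMap.congr_fun (Ring.inverse_mul_cancel _ hu) w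

theorem Jdef_Aop {e : Module.End ℂ (GT n)} (hu : IsUnit (Aop e)) (w : GT n) :
    Jdef e (Aop e w) = Aop e (Jcplx n w) := by
  simp [Jdef, inverse_Aop_apply hu]

theorem inverse_Aop_real {e : Module.End ℂ (GT n)} (hu : IsUnit (Aop e)) (w : GT n) :
    Ring.inverse (Aop e) (conjGT w) = conjGT (Ring.inverse (Aop e) w) := by
  conv_lhs => rw [← Aop_inverse_apply hu w, ← Aop_real, inverse_Aop_apply hu]

theorem IsBivector.isGenComplexVec_Jdef {e : Module.End ℂ (GT n)} (he : IsBivector e)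
    (hu : IsUnit (Aop e)) : IsGenComplexVec (Jdef e) where
  real w := by
    simp only [Jdef, Module.End.mul_apply, inverse_Aop_real hu, isGenComplexVec_Jcplx.real,
      Aop_real]
  orthogonal v w := by
    rw [← Aop_inverse_apply hu v, ← Aop_inverse_apply hu w, Jdef_Aop hu, Jdef_Aop hu, he.pair_Aop,
      he.pair_Aop, he.add_conjEnd_Jcplx, map_neg, he.add_conjEnd_Jcplx, neg_neg,
      isGenComplexVec_Jcplx.orthogonal, isGenComplexVec_Jcplx.orthogonal]
  sq w := by
    rw [← Aop_inverse_apply hu w, Jdef_Aop hu, Jdef_Aop hu, isGenComplexVec_Jcplx.sq, map_neg]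

theorem IsBivector.eigen_Jdef {e : Module.End ℂ (GT n)} (he : IsBivector e)
    (hu : IsUnit (Aop e)) : eigen (Jdef e) = (LJ n).map (1 + e) := by
  ext w
  rw [mem_eigen, Submodule.mem_map]
  constructor
  · intro h
    have hL : Ring.inverse (Aop e) w ∈ LJ n := by
      rw [LJ, mem_eigen]
      have := congrArg (⇑(Ring.inverse (Aop e))) h
      rwa [Jdef, Module.End.mul_apply, Module.End.mul_apply, inverse_Aop_apply hu, map_smul] at this
    exact ⟨_, hL, by rw [← he.Aop_eq hL, Aop_inverse_apply hu]⟩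
  · rintro ⟨y, hy, rfl⟩
    rw [← he.Aop_eq hy, Jdef_Aop hu, mem_eigen.1 hy, map_smul]

/-! ### Compatibility with the symplectic structure -/

section Compatible
variable {e : Module.End ℂ (GT n)}

theorem Jomega_mem_LJ {w : GT n} (hw : w ∈ LJ n) : Jomega n w ∈ LJ n := by
  have h := LinearMap.congr_fun (Jomega_mul_Jcplx (n := n)) w
  rw [LJ, mem_eigen] at *
  simpa [hw] using h.symm

theorem Jomega_mem_deformed (hc : ∀ w, Jomega n (e w) = e (Jomega n w)) {w : GT n}
    (hw : w ∈ (LJ n).map (1 + e)) : Jomega n w ∈ (LJ n).map (1 + e) := by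
  obtain ⟨y, hy, rfl⟩ := hw
  exact ⟨_, Jomega_mem_LJ hy, by simp [hc]⟩

theorem conjEnd_Jomega (hc : ∀ w, Jomega n (e w) = e (Jomega n w)) (w : GT n) :
    Jomega n (conjEnd e w) = conjEnd e (Jomega n w) := by
  rw [conjEnd_apply, conjEnd_apply, isGenComplexVec_Jomega.real, hc, isGenComplexVec_Jomega.real]

/-- The Hermitian form `⟨G v, ū⟩` for `G = -J_ω J_J`, written out. -/
theorem pair_Jomega_Jcplx (u v : GT n) :
    pair (-(Jomega n (Jcplx n v))) (conjGT u) =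
      ∑ A, (1 / 4 * (starRingEnd ℂ (u.1 A) * v.1 A) + starRingEnd ℂ (u.2 A) * v.2 A) := by
  have h1 : ∀ a b : ℂ, Complex.I / 2 * (Complex.I * a) * b = -(1 / 2) * (b * a) := fun a b => by
    linear_combination (a * b / 2) * Complex.I_sq
  have h2 : ∀ a b : ℂ, b * (2 * Complex.I * (Complex.I * a)) = -2 * (b * a) := fun a b => by
    linear_combination (2 * a * b) * Complex.I_sq
  simp [pair, ev, Jomega, Jcplx, omega, conjGT, conjIdx, Fintype.sum_sum_type,
    Finset.sum_add_distrib]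
  simp only [h1, h2, ← Finset.mul_sum]
  ring
end Compatible

/-! ### Positivity of the metric -/

/-- The isometry from the fibre, with the Hermitian metric `⟨G v, ū⟩` of the standard Kähler
structure, `G = -J_ω J_J`, onto a Euclidean space: it halves the vector part. -/
def toEuclidean (n : ℕ) : GT n ≃ₗ[ℂ] EuclideanSpace ℂ (Idx n ⊕ Idx n) where
  toFun w := WithLp.toLp 2 (Sum.elim ((1 / 2 : ℂ) • w.1) w.2)
  invFun x := (fun A => 2 * x (Sum.inl A), fun A => x (Sum.inr A))
  map_add' v w := by ext (A | A) <;> simp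
  map_smul' c w := by ext (A | A) <;> simp; ring
  left_inv w := by ext A <;> simp
  right_inv x := by ext (A | A) <;> simp

theorem inner_toEuclidean (u v : GT n) : inner ℂ (toEuclidean n u) (toEuclidean n v) =
    pair (-(Jomega n (Jcplx n v))) (conjGT u) := by
  rw [pair_Jomega_Jcplx, PiLp.inner_apply, Fintype.sum_sum_type, Finset.sum_add_distrib]
  congr 1 <;> refine Finset.sum_congr rfl fun A _ => ?_
  · simp [toEuclidean, Complex.conj_ofNat]; ring
  · simp [toEuclidean]; ring

theorem re_pair_eq_norm_sq {w : GT n} (hw : conjGT w = w) :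
    (pair (-(Jomega n (Jcplx n w))) w).re = ‖toEuclidean n w‖ ^ 2 := by
  have h := inner_toEuclidean w w
  rw [hw] at h
  rw [← h, ← inner_self_eq_norm_sq (𝕜 := ℂ)]
  rfl

section Positivity
variable {e : Module.End ℂ (GT n)}

theorem add_conjEnd_Jomega (hc : ∀ w, Jomega n (e w) = e (Jomega n w)) (w : GT n) :
    Jomega n ((e + conjEnd e) w) = (e + conjEnd e) (Jomega n w) := by
  simp only [LinearMap.add_apply, map_add, hc, conjEnd_Jomega hc]

theorem add_conjEnd_real (w : GT n) :
    (e + conjEnd e) (conjGT w) = conjGT ((e + conjEnd e) w) := by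
  simp only [LinearMap.add_apply, conjEnd_apply, conjGT_add, conjGT_conjGT]
  abel

/-- `ε + ε̄` anticommutes with `G` and is skew for the natural metric, hence symmetric for the
Hermitian metric `⟨G v, ū⟩`. -/
theorem IsBivector.inner_add_conjEnd (he : IsBivector e)
    (hc : ∀ w, Jomega n (e w) = e (Jomega n w)) (u v : GT n) :
    inner ℂ (toEuclidean n ((e + conjEnd e) u)) (toEuclidean n v) =
      inner ℂ (toEuclidean n u) (toEuclidean n ((e + conjEnd e) v)) := by
  have h : Jcplx n ((e + conjEnd e) v) = -((e + conjEnd e) (Jcplx n v)) := by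
    rw [he.add_conjEnd_Jcplx, neg_neg]
  rw [inner_toEuclidean, inner_toEuclidean, ← add_conjEnd_real, h, map_neg, neg_neg,
    add_conjEnd_Jomega hc, he.add_conjEnd_skew, pair_neg_left]

/-- If `A_{tε}` is invertible for `0 ≤ t ≤ 1`, then `ε + ε̄` has no eigenvalue in `(-∞, -1]`; since
it anticommutes with `J_J`, its eigenvalues are symmetric about zero, and it is a strict
contraction. -/
theorem IsBivector.norm_add_conjEnd_lt (he : IsBivector e)
    (hc : ∀ w, Jomega n (e w) = e (Jomega n w))
    (hu : ∀ t ∈ Set.Icc (0 : ℝ) 1, IsUnit (Aop ((t : ℂ) • e))) {w : GT n} (hw : w ≠ 0) :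
    ‖toEuclidean n ((e + conjEnd e) w)‖ < ‖toEuclidean n w‖ := by
  set N := e + conjEnd e with hN
  -- `1 + r⁻¹ N` kills eigenvectors with eigenvalue `-r`
  have hneg : ∀ r : ℝ, 1 ≤ r → ∀ v : GT n, N v = -((r : ℂ) • v) → v = 0 := by
    intro r hr v hv
    have hinj := hu r⁻¹ ⟨by positivity, inv_le_one_of_one_le₀ hr⟩
    have h0 : Aop (((r⁻¹ : ℝ) : ℂ) • e) v = 0 := by
      have : (r : ℂ) ≠ 0 := by exact_mod_cast (zero_lt_one.trans_le hr).ne'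
      rw [Aop_ofReal_smul, LinearMap.add_apply, LinearMap.smul_apply, ← hN, hv, smul_neg, smul_smul,
        Complex.ofReal_inv, inv_mul_cancel₀ this]
      simp
    rw [← inverse_Aop_apply hinj v, h0, map_zero]
  have hT : LinearMap.IsSymmetric
      ((toEuclidean n).toLinearMap ∘ₗ N ∘ₗ (toEuclidean n).symm.toLinearMap) := by
    intro x y
    have := he.inner_add_conjEnd hc ((toEuclidean n).symm x) ((toEuclidean n).symm y)
    rw [← hN] at this
    simpa using this
  have key := hT.norm_apply_lt (x := toEuclidean n w) ?_ (by simpa using hw)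
  · simpa using key
  intro r x hx hrx
  by_contra! hr
  have hv0 : (toEuclidean n).symm x ≠ 0 := by simpa using hx
  have hv : N ((toEuclidean n).symm x) = (r : ℂ) • (toEuclidean n).symm x := by
    apply (toEuclidean n).injective
    rw [map_smul, LinearEquiv.apply_symm_apply]
    exact hrx
  set v := (toEuclidean n).symm x
  -- if `N v = r v` then `N (J_J v) = -r (J_J v)`
  rcases le_abs.1 hr with h | h
  · refine hv0 ?_
    have h1 := hneg r h (Jcplx n v) (by rw [hN, he.add_conjEnd_Jcplx, ← hN, hv, map_smul])
    have h2 := isGenComplexVec_Jcplx.sq v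
    rwa [h1, map_zero, eq_comm, neg_eq_zero] at h2
  · exact hv0 (hneg (-r) h v (by rw [hv]; simp))

/-- With `w = A_ε u` and `N = ε + ε̄` the metric is
`⟨-J_ω J_ε w, w⟩ = ⟨G u, u⟩ - ⟨G N u, N u⟩`. -/
theorem IsBivector.isPosMetric (he : IsBivector e)
    (hc : ∀ w, Jomega n (e w) = e (Jomega n w))
    (hu : ∀ t ∈ Set.Icc (0 : ℝ) 1, IsUnit (Aop ((t : ℂ) • e))) :
    IsPosMetric (-(Jomega n * Jdef e)) := by
  have hu1 : IsUnit (Aop e) := by simpa using hu 1 (by simp)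
  have hJ := he.isGenComplexVec_Jdef hu1
  have hcomm : ∀ w, Jomega n (Jdef e w) = Jdef e (Jomega n w) := fun w =>
    LinearMap.congr_fun (hJ.commute_of_mapsTo_eigen isGenComplexVec_Jomega.real fun w hw => by
      rw [he.eigen_Jdef hu1] at hw ⊢
      exact Jomega_mem_deformed hc hw) w
  have hA : ∀ w, Jomega n (Aop e w) = Aop e (Jomega n w) := fun w => by
    simp only [Aop_apply, map_add, hc, conjEnd_Jomega hc]
  refine ⟨fun w => ?_, fun w => ?_, fun v w => ?_, fun w hw hw0 => ?_⟩
  · simp [hJ.real, isGenComplexVec_Jomega.real, conjGT_neg]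
  · simp [← hcomm, hJ.sq, isGenComplexVec_Jomega.sq]
  · simp [pair_neg_left, pair_neg_right, hJ.orthogonal, isGenComplexVec_Jomega.orthogonal]
  · obtain ⟨u, rfl⟩ : ∃ u, Aop e u = w := ⟨_, Aop_inverse_apply hu1 w⟩
    have hur : conjGT u = u := by
      rw [← inverse_Aop_apply hu1 (conjGT u), Aop_real, hw, inverse_Aop_apply hu1]
    have hu0 : u ≠ 0 := by rintro rfl; simp at hw0
    have hNr : conjGT ((e + conjEnd e) u) = (e + conjEnd e) u := by rw [← add_conjEnd_real, hur]
    have h2 : pair ((e + conjEnd e) ((e + conjEnd e) (Jomega n (Jcplx n u)))) u =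
        pair (Jomega n (Jcplx n ((e + conjEnd e) u))) ((e + conjEnd e) u) := by
      rw [he.add_conjEnd_skew, ← add_conjEnd_Jomega hc, he.add_conjEnd_Jcplx, map_neg,
        pair_neg_left, neg_neg]
    rw [LinearMap.neg_apply, Module.End.mul_apply, Jdef_Aop hu1, hA, pair_neg_left, he.pair_Aop, h2]
    have h3 := re_pair_eq_norm_sq hur
    have h4 := re_pair_eq_norm_sq hNr
    rw [pair_neg_left, Complex.neg_re] at h3 h4
    rw [Complex.neg_re, Complex.sub_re]
    have := pow_lt_pow_left₀ (he.norm_add_conjEnd_lt hc hu hu0) (norm_nonneg _) two_ne_zero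
    linarith
end Positivity

/-! ### Complex partial derivatives of vector-valued functions -/

section Derivatives
variable {E : Type*} [NormedAddCommGroup E] [NormedSpace ℝ E] [NormedSpace ℂ E]
  {E' : Type*} [NormedAddCommGroup E'] [NormedSpace ℝ E'] [NormedSpace ℂ E']

/-- The value on `∂/∂z_i` or `∂/∂z̄_i` of the complex linear extension of a real linear map. -/
def complexDir (A : Idx n) (φ : (Fin n → ℂ) →L[ℝ] E) : E :=
  match A with
  | Sum.inl i => (1 / 2 : ℂ) • (φ (Pi.single i 1) - Complex.I • φ (Pi.single i Complex.I))
  | Sum.inr i => (1 / 2 : ℂ) • (φ (Pi.single i 1) + Complex.I • φ (Pi.single i Complex.I))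

/-- The derivatives `∂/∂z_i` and `∂/∂z̄_i` of a vector-valued function. -/
def vpd (A : Idx n) (s : (Fin n → ℂ) → E) (z : Fin n → ℂ) : E := complexDir A (fderiv ℝ s z)

theorem pd_eq_vpd (A : Idx n) (f : (Fin n → ℂ) → ℂ) (z : Fin n → ℂ) : pd A f z = vpd A f z := by
  rcases A with i | i <;> rfl

theorem complexDir_comp (A : Idx n) (T : E →ₗ[ℂ] E') {φ : (Fin n → ℂ) →L[ℝ] E}
    {ψ : (Fin n → ℂ) →L[ℝ] E'} (h : ∀ v, ψ v = T (φ v)) :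
    complexDir A ψ = T (complexDir A φ) := by
  rcases A with i | i <;> simp [complexDir, h]

theorem complexDir_zero (A : Idx n) : complexDir A (0 : (Fin n → ℂ) →L[ℝ] E) = 0 := by
  rcases A with i | i <;> simp [complexDir]

theorem complexDir_add (A : Idx n) (φ ψ : (Fin n → ℂ) →L[ℝ] E) :
    complexDir A (φ + ψ) = complexDir A φ + complexDir A ψ := by
  rcases A with i | i <;> simp only [complexDir, _root_.add_apply] <;> module

theorem vpd_congr {s t : (Fin n → ℂ) → E} {z : Fin n → ℂ} (h : s =ᶠ[𝓝 z] t)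
    (A : Idx n) : vpd A s z = vpd A t z := by
  rw [vpd, vpd, h.fderiv_eq]

theorem vpd_const (A : Idx n) (c : E) (z : Fin n → ℂ) : vpd A (fun _ => c) z = 0 := by
  rw [vpd, fderiv_const_apply, complexDir_zero]

theorem vpd_linear [IsScalarTower ℝ ℂ E] [IsScalarTower ℝ ℂ E'] [FiniteDimensional ℂ E]
    (A : Idx n) (T : E →ₗ[ℂ] E') {s : (Fin n → ℂ) → E}
    {z : Fin n → ℂ} (hs : DifferentiableAt ℝ s z) :
    vpd A (fun p => T (s p)) z = T (vpd A s z) := by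
  have h := ((LinearMap.toContinuousLinearMap T).restrictScalars ℝ).hasFDerivAt.comp z
    hs.hasFDerivAt
  rw [vpd, show fderiv ℝ (fun p => T (s p)) z = _ from h.fderiv]
  exact complexDir_comp A T fun v => rfl

theorem vpd_add (A : Idx n) {s t : (Fin n → ℂ) → E} {z : Fin n → ℂ} (hs : DifferentiableAt ℝ s z)
    (ht : DifferentiableAt ℝ t z) :
    vpd A (fun p => s p + t p) z = vpd A s z + vpd A t z := by
  rw [vpd, fderiv_fun_add hs ht, complexDir_add]; rfl

theorem vpd_sum {ι : Type*} (A : Idx n) {u : Finset ι} {s : ι → (Fin n → ℂ) → E} {z : Fin n → ℂ}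
    (hs : ∀ i ∈ u, DifferentiableAt ℝ (s i) z) :
    vpd A (fun p => ∑ i ∈ u, s i p) z = ∑ i ∈ u, vpd A (s i) z := by
  classical
  induction u using Finset.induction_on with
  | empty => simp [vpd_const]
  | insert i u hi ih =>
    simp only [Finset.sum_insert hi]
    rw [vpd_add A (hs i (by simp)) (DifferentiableAt.fun_sum fun j hj => hs j (by simp [hj])),
      ih fun j hj => hs j (by simp [hj])]

theorem vpd_smul [IsScalarTower ℝ ℂ E] (A : Idx n) {f : (Fin n → ℂ) → ℂ} {s : (Fin n → ℂ) → E}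
    {z : Fin n → ℂ}
    (hf : DifferentiableAt ℝ f z) (hs : DifferentiableAt ℝ s z) :
    vpd A (fun p => f p • s p) z = pd A f z • s z + f z • vpd A s z := by
  rw [vpd, fderiv_fun_smul hf hs, complexDir_add, add_comm, pd_eq_vpd]
  congr 1
  · exact complexDir_comp A (LinearMap.toSpanSingleton ℂ E (s z)) fun v => by simp
  · exact complexDir_comp A (f z • (LinearMap.id : E →ₗ[ℂ] E)) fun v => by simp

theorem vpd_mul (A : Idx n) {f g : (Fin n → ℂ) → ℂ} {z : Fin n → ℂ}
    (hf : DifferentiableAt ℝ f z) (hg : DifferentiableAt ℝ g z) :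
    vpd A (fun p => f p * g p) z = vpd A f z * g z + f z * vpd A g z := by
  simpa only [smul_eq_mul, pd_eq_vpd] using vpd_smul A hf hg

/-- A holomorphic function satisfies the Cauchy–Riemann equations `∂f/∂z̄_i = 0`. -/
theorem pd_inr_eq_zero {f : (Fin n → ℂ) → ℂ} (hf : Differentiable ℂ f) (i : Fin n)
    (z : Fin n → ℂ) : pd (Sum.inr i) f z = 0 := by
  have h : (Pi.single i Complex.I : Fin n → ℂ) = Complex.I • Pi.single i 1 := by
    rw [← Pi.single_smul, smul_eq_mul, mul_one]
  rw [pd, (hf z).fderiv_restrictScalars ℝ, h]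
  simp only [ContinuousLinearMap.coe_restrictScalars', map_smul, smul_eq_mul, ← mul_assoc,
    Complex.I_mul_I]
  ring

end Derivatives

/-! ### The Courant bracket of isotropic sections -/

section Courant
variable {s t : (Fin n → ℂ) → GT n} {z : Fin n → ℂ}

theorem pd_fst (hs : DifferentiableAt ℝ s z) (A B : Idx n) :
    pd A (fun p => (s p).1 B) z = (vpd A s z).1 B := by
  rw [pd_eq_vpd]
  exact vpd_linear A (LinearMap.proj B ∘ₗ LinearMap.fst ℂ (Idx n → ℂ) (Idx n → ℂ)) hs

theorem pd_snd (hs : DifferentiableAt ℝ s z) (A B : Idx n) :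
    pd A (fun p => (s p).2 B) z = (vpd A s z).2 B := by
  rw [pd_eq_vpd]
  exact vpd_linear A (LinearMap.proj B ∘ₗ LinearMap.snd ℂ (Idx n → ℂ) (Idx n → ℂ)) hs

theorem differentiableAt_fst (hs : DifferentiableAt ℝ s z) (B : Idx n) :
    DifferentiableAt ℝ (fun p => (s p).1 B) z :=
  differentiableAt_pi.1 hs.fst B

theorem differentiableAt_snd (hs : DifferentiableAt ℝ s z) (B : Idx n) :
    DifferentiableAt ℝ (fun p => (s p).2 B) z :=
  differentiableAt_pi.1 hs.snd B

theorem pd_ev (hs : DifferentiableAt ℝ s z) (ht : DifferentiableAt ℝ t z) (A : Idx n) :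
    pd A (fun p => ev (s p).2 (t p).1) z =
      ev (vpd A s z).2 (t z).1 + ev (s z).2 (vpd A t z).1 := by
  simp only [ev]
  rw [pd_eq_vpd,
    vpd_sum A fun B _ => (differentiableAt_snd hs B).fun_mul (differentiableAt_fst ht B),
    ← Finset.sum_add_distrib]
  refine Finset.sum_congr rfl fun B _ => ?_
  rw [vpd_mul A (differentiableAt_snd hs B) (differentiableAt_fst ht B), ← pd_eq_vpd, ← pd_eq_vpd,
    pd_snd hs, pd_fst ht]

theorem vpd_pair (hs : DifferentiableAt ℝ s z) (ht : DifferentiableAt ℝ t z) (A : Idx n) :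
    vpd A (fun p => pair (s p) (t p)) z = pair (vpd A s z) (t z) + pair (s z) (vpd A t z) := by
  have hd : ∀ {s t : (Fin n → ℂ) → GT n}, DifferentiableAt ℝ s z → DifferentiableAt ℝ t z →
      DifferentiableAt ℝ (fun p => ev (s p).2 (t p).1) z := fun hs ht =>
    DifferentiableAt.fun_sum fun B _ =>
      (differentiableAt_snd hs B).fun_mul (differentiableAt_fst ht B)
  simp only [pair]
  rw [vpd_mul A (differentiableAt_const _) ((hd hs ht).fun_add (hd ht hs)), vpd_const,
    vpd_add A (hd hs ht) (hd ht hs), ← pd_eq_vpd, ← pd_eq_vpd, pd_ev hs ht, pd_ev ht hs]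
  ring

/-- The Courant bracket in terms of the flat derivative, where `s` and `t` are orthogonal: with the
derivatives along the vector parts of `s` and `t`,
`[s, t] = ∇_s t - ∇_t s + 2 ∑ ⟨∂_A s, t⟩ dz_A`. -/
theorem courant_eq_of_isotropic (hs : DifferentiableAt ℝ s z) (ht : DifferentiableAt ℝ t z)
    (h : ∀ᶠ p in 𝓝 z, pair (s p) (t p) = 0) :
    courant s t z = ∑ A, (s z).1 A • vpd A t z - ∑ A, (t z).1 A • vpd A s z
      + (0, fun A => 2 * pair (vpd A s z) (t z)) := by
  have h0 : ∀ A, pair (vpd A s z) (t z) + pair (s z) (vpd A t z) = 0 := fun A => by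
    rw [← vpd_pair hs ht, vpd_congr (t := fun _ => 0) h, vpd_const]
  refine Prod.ext (funext fun B => ?_) (funext fun B => ?_)
  · simp [courant, lieBr, dirDeriv, pd_fst hs, pd_fst ht, Prod.fst_sum, Finset.sum_apply]
  · have h1 := h0 B
    simp only [courant, lieDerivForm, dirDeriv, dFun, pd_fst hs, pd_fst ht, pd_snd hs, pd_snd ht,
      pd_ev hs ht, pd_ev ht hs, Prod.snd_add, Prod.snd_sub, Prod.snd_sum, Prod.smul_snd,
      Pi.add_apply, Pi.sub_apply, Pi.smul_apply, Finset.sum_apply, smul_eq_mul]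
    simp only [pair] at h1 ⊢
    -- the sums that make up the Lie derivatives are evaluations of covectors
    change _ + ev (t z).2 (vpd B s z).1 - (_ + ev (s z).2 (vpd B t z).1) - _ = _
    linear_combination -h1

/-- A criterion for the bracket of orthogonal sections to lie in `D`, term by term. -/
theorem courant_mem_of_isotropic {D : Submodule ℂ (GT n)} (hs : DifferentiableAt ℝ s z)
    (ht : DifferentiableAt ℝ t z) (h : ∀ᶠ p in 𝓝 z, pair (s p) (t p) = 0)
    (hst : ∀ A, (s z).1 A • vpd A t z ∈ D) (hts : ∀ A, (t z).1 A • vpd A s z ∈ D)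
    (hd : ((0, fun A => 2 * pair (vpd A s z) (t z)) : GT n) ∈ D) : courant s t z ∈ D := by
  rw [courant_eq_of_isotropic hs ht h]
  exact add_mem (sub_mem (sum_mem fun A _ => hst A) (sum_mem fun A _ => hts A)) hd

/-- The eigenbundle of a constant orthogonal structure is closed under the Courant bracket. -/
theorem IsGenComplexVec.courantClosedOn {J : Module.End ℂ (GT n)} (hJ : IsGenComplexVec J)
    (U : Set (Fin n → ℂ)) : CourantClosedOn U fun _ => eigen J := by
  intro V hV _ s t hs ht hsJ htJ z hz
  have hVz := hV.mem_nhds hz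
  have hd : ∀ {s : (Fin n → ℂ) → GT n}, ContDiffOn ℝ ∞ s V → DifferentiableAt ℝ s z := fun h =>
    (h.contDiffAt hVz).differentiableAt (by simp)
  have hmem : ∀ {s : (Fin n → ℂ) → GT n}, DifferentiableAt ℝ s z → (∀ p ∈ V, s p ∈ eigen J) →
      ∀ A, vpd A s z ∈ eigen J := by
    intro s hs h A
    have h1 := vpd_congr (s := fun p => J (s p)) 
      (t := fun p => (Complex.I • (LinearMap.id : Module.End ℂ (GT n))) (s p))
      (eventually_of_mem hVz fun p hp => mem_eigen.1 (h p hp)) A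
    rw [vpd_linear A J hs, vpd_linear A _ hs] at h1
    exact mem_eigen.2 h1
  refine courant_mem_of_isotropic (hd hs) (hd ht)
    (eventually_of_mem hVz fun p hp => hJ.eigen_isotropic (hsJ p hp) (htJ p hp))
    (fun A => Submodule.smul_mem _ _ (hmem (hd ht) htJ A))
    (fun A => Submodule.smul_mem _ _ (hmem (hd hs) hsJ A)) ?_
  have h0 : ∀ A, pair (vpd A s z) (t z) = 0 := fun A =>
    hJ.eigen_isotropic (hmem (hd hs) hsJ A) (htJ z hz)
  simp only [h0, mul_zero]
  exact zero_mem _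

end Courant

/-! ### Closedness of the deformed eigenbundle -/

/-- A constant element of `∧² L̄` involving only directions in `I`: the vector parts of its values
lie in the span of the `∂/∂z_i`, `i ∈ I`, and it vanishes on the covectors without `dz_k`
components for `k ∈ I`. -/
structure IsBivectorIn (I : Finset (Fin n)) (W : Module.End ℂ (GT n)) : Prop extends
    IsBivector W where
  fst_inl : ∀ w, ∀ k ∉ I, (W w).1 (Sum.inl k) = 0
  apply_covector : ∀ g : Idx n → ℂ, (∀ k ∈ I, g (Sum.inl k) = 0) → W (0, g) = 0

/-- The projection onto `L` along `L̄`. -/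
def projL (n : ℕ) : Module.End ℂ (GT n) := (1 / 2 : ℂ) • (1 - Complex.I • Jcplx n)

theorem projL_mem (w : GT n) : projL n w ∈ LJ n :=
  Submodule.smul_mem _ _ (isGenComplexVec_Jcplx.sub_mem_eigen w)

theorem projL_of_mem {w : GT n} (hw : w ∈ LJ n) : projL n w = w := by
  simp only [projL, LinearMap.smul_apply, LinearMap.sub_apply, Module.End.one_apply,
    mem_eigen.1 hw, smul_smul, Complex.I_mul_I]
  module

theorem IsBivector.projL_apply {e : Module.End ℂ (GT n)} (he : IsBivector e) (w : GT n) :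
    projL n (e w) = 0 := by
  simp only [projL, LinearMap.smul_apply, LinearMap.sub_apply, Module.End.one_apply, he.left,
    smul_neg, smul_smul, Complex.I_mul_I]
  module

theorem IsBivector.eq_of_mem_deformed {e : Module.End ℂ (GT n)} (he : IsBivector e) {w : GT n}
    (hw : w ∈ (LJ n).map (1 + e)) : w = projL n w + e (projL n w) := by
  obtain ⟨y, hy, rfl⟩ := hw
  simp [he.projL_apply, projL_of_mem hy]

theorem fst_inl_of_mem_LJ {w : GT n} (hw : w ∈ LJ n) (k : Fin n) : w.1 (Sum.inl k) = 0 := by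
  have h := congrFun (congrArg Prod.fst (mem_eigen.1 hw)) (Sum.inl k)
  simp only [Jcplx, LinearMap.coe_mk, AddHom.coe_mk, Sum.elim_inl, Prod.smul_fst, Pi.smul_apply,
    smul_eq_mul, neg_mul] at h
  simpa using neg_eq_self.1 h

theorem covector_mem_LJ {g : Idx n → ℂ} (hg : ∀ k, g (Sum.inr k) = 0) : ((0, g) : GT n) ∈ LJ n := by
  rw [LJ, mem_eigen]
  ext (k | k) <;> simp [Jcplx, hg]

/-- The section `∑ F_a W_a` of `∧² L̄`. -/
def bivectorField {ι : Type*} (S : Finset ι) (F : ι → (Fin n → ℂ) → ℂ)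
    (W : ι → Module.End ℂ (GT n)) (z : Fin n → ℂ) : Module.End ℂ (GT n) :=
  ∑ a ∈ S, F a z • W a

section Field
variable {ι : Type*} {S : Finset ι} {F : ι → (Fin n → ℂ) → ℂ} {W : ι → Module.End ℂ (GT n)}
  {I : Finset (Fin n)}

theorem isBivector_bivectorField (hW : ∀ a ∈ S, IsBivectorIn I (W a)) (z : Fin n → ℂ) :
    IsBivector (bivectorField S F W z) :=
  IsBivector.sum fun a ha => (hW a ha).toIsBivector.smul _

/-- The Leibniz rule for a section `(1 + ε) σ` of `L_ε`, `σ` being its projection to `L`. -/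
theorem vpd_deformed (hW : ∀ a ∈ S, IsBivectorIn I (W a)) {z : Fin n → ℂ}
    (hF : ∀ a ∈ S, DifferentiableAt ℝ (F a) z) {s : (Fin n → ℂ) → GT n}
    (hs : DifferentiableAt ℝ s z)
    (hmem : ∀ᶠ p in 𝓝 z, s p ∈ deformed (bivectorField S F W) p) (A : Idx n) :
    vpd A s z = (1 + bivectorField S F W z) (projL n (vpd A s z))
      + ∑ a ∈ S, pd A (F a) z • W a (projL n (s z)) := by
  have hT : ∀ T : Module.End ℂ (GT n), DifferentiableAt ℝ (fun p => T (s p)) z := fun T =>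
    ((LinearMap.toContinuousLinearMap T).restrictScalars ℝ).differentiableAt.comp z hs
  have heq : s =ᶠ[𝓝 z] fun p => projL n (s p) + ∑ a ∈ S, F a p • (W a * projL n) (s p) := by
    filter_upwards [hmem] with p hp
    conv_lhs => rw [(isBivector_bivectorField hW p).eq_of_mem_deformed hp]
    simp [bivectorField]
  have hd : ∀ a ∈ S, DifferentiableAt ℝ (fun p => F a p • (W a * projL n) (s p)) z := fun a ha =>
    (hF a ha).fun_smul (hT _)
  conv_lhs => rw [vpd_congr heq, vpd_add A (hT _) (DifferentiableAt.fun_sum hd), vpd_sum A hd,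
    vpd_linear A _ hs]
  rw [LinearMap.add_apply, Module.End.one_apply, add_assoc, bivectorField, LinearMap.sum_apply,
    ← Finset.sum_add_distrib]
  congr 1
  refine Finset.sum_congr rfl fun a ha => ?_
  rw [vpd_smul A (hF a ha) (hT _), vpd_linear A _ hs, add_comm]
  rfl

/-- `L_ε` is closed under the Courant bracket when the coefficients are holomorphic and constant
in the `z_k`, `k ∈ I`: the vector part of a section of `L_ε` differentiates only in directions in
which `ε` is constant, and `∂_A ε ≠ 0` only for `A = z_k` with `k ∉ I`, where `dz_k` is a section
of `L_ε`. -/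
theorem courantClosedOn_deformed (hW : ∀ a ∈ S, IsBivectorIn I (W a))
    (hF : ∀ a ∈ S, Differentiable ℂ (F a))
    (hd : ∀ a ∈ S, ∀ k ∈ I, ∀ z, pd (Sum.inl k) (F a) z = 0) :
    CourantClosedOn Set.univ (deformed (bivectorField S F W)) := by
  intro V hV _ s t hs ht hsL htL z hz
  have hVz := hV.mem_nhds hz
  have hbiv := isBivector_bivectorField (F := F) hW
  have hdiff : ∀ {s : (Fin n → ℂ) → GT n}, ContDiffOn ℝ ∞ s V → DifferentiableAt ℝ s z := fun h =>
    (h.contDiffAt hVz).differentiableAt (by simp)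
  have hFR : ∀ a ∈ S, DifferentiableAt ℝ (F a) z := fun a ha => (hF a ha z).restrictScalars ℝ
  have hL : ∀ y, (1 + bivectorField S F W z) (projL n y) ∈ deformed (bivectorField S F W) z :=
    fun y => ⟨_, projL_mem y, rfl⟩
  -- away from the directions `z_k`, `k ∉ I`, the derivative of a section is a section
  have hvpd : ∀ {s : (Fin n → ℂ) → GT n}, ContDiffOn ℝ ∞ s V →
      (∀ p ∈ V, s p ∈ deformed (bivectorField S F W) p) → ∀ A, (∀ k ∉ I, A ≠ Sum.inl k) →
      vpd A s z ∈ deformed (bivectorField S F W) z := by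
    intro s hs hsL A hA
    rw [vpd_deformed hW hFR (hdiff hs) (eventually_of_mem hVz hsL) A, Finset.sum_eq_zero, add_zero]
    · exact hL _
    · intro a ha
      suffices pd A (F a) z = 0 by rw [this, zero_smul]
      rcases A with k | k
      · exact hd a ha k (by by_contra hk; exact hA k hk rfl) z
      · exact pd_inr_eq_zero (hF a ha) k z
  have hfst : ∀ w ∈ deformed (bivectorField S F W) z, ∀ k ∉ I, w.1 (Sum.inl k) = 0 := by
    rintro _ ⟨y, hy, rfl⟩ k hk
    simp only [LinearMap.add_apply, Module.End.one_apply, bivectorField, LinearMap.sum_apply,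
      LinearMap.smul_apply, Prod.fst_add, Prod.fst_sum, Prod.smul_fst, Pi.add_apply,
      Finset.sum_apply, Pi.smul_apply, fst_inl_of_mem_LJ hy, zero_add]
    exact Finset.sum_eq_zero fun a ha => by rw [(hW a ha).fst_inl y k hk, smul_zero]
  have hsmul : ∀ w ∈ deformed (bivectorField S F W) z, ∀ {s : (Fin n → ℂ) → GT n},
      ContDiffOn ℝ ∞ s V → (∀ p ∈ V, s p ∈ deformed (bivectorField S F W) p) →
      ∀ A, w.1 A • vpd A s z ∈ deformed (bivectorField S F W) z := by
    intro w hw s hs hsL A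
    by_cases hA : ∀ k ∉ I, A ≠ Sum.inl k
    · exact Submodule.smul_mem _ _ (hvpd hs hsL A hA)
    · push Not at hA
      obtain ⟨k, hk, rfl⟩ := hA
      rw [hfst w hw k hk, zero_smul]
      exact zero_mem _
  refine courant_mem_of_isotropic (hdiff hs) (hdiff ht)
    (eventually_of_mem hVz fun p hp => (hbiv p).deformed_isotropic (hsL p hp) (htL p hp))
    (hsmul _ (hsL z hz) ht htL) (hsmul _ (htL z hz) hs hsL) ?_
  have h0 : ∀ A, (∀ k ∉ I, A ≠ Sum.inl k) → 2 * pair (vpd A s z) (t z) = 0 := fun A hA => by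
    rw [(hbiv z).deformed_isotropic (hvpd hs hsL A hA) (htL z hz), mul_zero]
  have hI : ∀ k ∈ I, 2 * pair (vpd (Sum.inl k) s z) (t z) = 0 := fun k hk =>
    h0 _ fun l hl h => hl (Sum.inl_injective h ▸ hk)
  refine ⟨_, covector_mem_LJ (g := fun A => 2 * pair (vpd A s z) (t z)) fun k => h0 _ (by simp), ?_⟩
  rw [LinearMap.add_apply, Module.End.one_apply, bivectorField, LinearMap.sum_apply,
    Finset.sum_eq_zero fun a ha => by
      rw [LinearMap.smul_apply, (hW a ha).apply_covector _ hI, smul_zero], add_zero]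

/-! ### The deformed structure as a smooth family -/

/-- Smoothness of `A_ε`, as a function with values in the Banach algebra of continuous
endomorphisms. -/
theorem contDiff_Aop (hF : ∀ a ∈ S, Differentiable ℂ (F a)) :
    ContDiff ℝ ∞ fun z =>
      Module.End.toContinuousLinearMap (GT n) (Aop (bivectorField S F W z)) := by
  have h : ∀ z, Module.End.toContinuousLinearMap (GT n) (Aop (bivectorField S F W z)) =
      1 + ∑ a ∈ S, F a z • Module.End.toContinuousLinearMap (GT n) (W a)
        + ∑ a ∈ S, starRingEnd ℂ (F a z) •
          Module.End.toContinuousLinearMap (GT n) (conjEnd (W a)) := by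
    intro z
    have hc : conjEnd (bivectorField S F W z) = ∑ a ∈ S, starRingEnd ℂ (F a z) • conjEnd (W a) := by
      refine LinearMap.ext fun w => ?_
      have hsum : ∀ f : ι → GT n, conjGT (∑ a ∈ S, f a) = ∑ a ∈ S, conjGT (f a) := fun f =>
        map_sum (AddMonoidHom.mk' conjGT conjGT_add) f S
      simp only [conjEnd_apply, bivectorField, LinearMap.sum_apply, LinearMap.smul_apply, hsum,
        conjGT_smul]
    rw [Aop, hc, bivectorField]
    simp only [map_add, map_one, map_sum, map_smul]
  simp only [h]
  have hFs : ∀ a ∈ S, ContDiff ℝ ∞ (F a) := fun a ha =>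
    (hF a ha).contDiff_of_finiteDimensional.restrict_scalars ℝ
  refine (contDiff_const.add (ContDiff.sum fun a ha => (hFs a ha).smul contDiff_const)).add
    (ContDiff.sum fun a ha => ?_)
  exact (Complex.conjCLE.contDiff.comp (hFs a ha)).smul contDiff_const

theorem contDiffOn_Jdef (hF : ∀ a ∈ S, Differentiable ℂ (F a)) {U : Set (Fin n → ℂ)}
    (hu : ∀ z ∈ U, IsUnit (Aop (bivectorField S F W z))) (w : GT n) :
    ContDiffOn ℝ ∞ (fun z => Jdef (bivectorField S F W z) w) U := by
  set Φ := Module.End.toContinuousLinearMap (𝕜 := ℂ) (GT n)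
  have hA : ContDiff ℝ ∞ fun z => Φ (Aop (bivectorField S F W z)) := contDiff_Aop hF
  have hinv : ∀ a : Module.End ℂ (GT n), IsUnit a → Φ (Ring.inverse a) = Ring.inverse (Φ a) := by
    rintro _ ⟨u, rfl⟩
    have h : Φ (u : Module.End ℂ (GT n)) = (Units.map (Φ : _ →* _) u : (GT n →L[ℂ] GT n)ˣ) := rfl
    rw [h, Ring.inverse_unit, Ring.inverse_unit]
    rfl
  have hI : ContDiffOn ℝ ∞ (fun z => Ring.inverse (Φ (Aop (bivectorField S F W z)))) U := by
    intro z hz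
    obtain ⟨v, hv⟩ := (hu z hz).map Φ
    have h1 := (contDiffAt_ringInverse ℂ (n := ∞) v).restrict_scalars ℝ
    rw [hv] at h1
    exact (h1.comp z hA.contDiffAt).contDiffWithinAt
  have h2 : ContDiffOn ℝ ∞ (fun z => (Φ (Aop (bivectorField S F W z)) * Φ (Jcplx n) *
      Ring.inverse (Φ (Aop (bivectorField S F W z)))) w) U :=
    (((ContinuousLinearMap.apply ℂ (GT n) w).restrictScalars ℝ).contDiff.comp_contDiffOn
      ((hA.contDiffOn.mul contDiffOn_const).mul hI))
  refine h2.congr fun z hz => ?_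
  rw [← hinv _ (hu z hz), ← map_mul, ← map_mul]
  rfl

theorem isDeformationOn_Jdef (hW : ∀ a ∈ S, IsBivectorIn I (W a))
    (hF : ∀ a ∈ S, Differentiable ℂ (F a))
    (hd : ∀ a ∈ S, ∀ k ∈ I, ∀ z, pd (Sum.inl k) (F a) z = 0) {U : Set (Fin n → ℂ)}
    (hu : ∀ z ∈ U, IsUnit (Aop (bivectorField S F W z))) :
    IsDeformationOn U (bivectorField S F W) fun z => Jdef (bivectorField S F W z) := by
  have hbiv := isBivector_bivectorField (F := F) hW
  have heig : ∀ z ∈ U, eigen (Jdef (bivectorField S F W z)) = deformed (bivectorField S F W) z :=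
    fun z hz => (hbiv z).eigen_Jdef (hu z hz)
  refine ⟨⟨contDiffOn_Jdef hF hu, fun z hz => (hbiv z).isGenComplexVec_Jdef (hu z hz), ?_⟩, heig⟩
  intro V hV hVU s t hs ht hsL htL z hz
  change _ ∈ eigen (Jdef (bivectorField S F W z))
  rw [heig z (hVU hz)]
  exact courantClosedOn_deformed hW hF hd V hV (Set.subset_univ _) s t hs ht
    (fun p hp => heig p (hVU hp) ▸ hsL p hp) (fun p hp => heig p (hVU hp) ▸ htL p hp) z hz

/-- On a bounded set `ε + ε̄` is bounded in operator norm, so `A_{tε}` is invertible for all small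
`t`. -/
theorem isUnit_Aop_of_bounded (hF : ∀ a ∈ S, Differentiable ℂ (F a)) {U : Set (Fin n → ℂ)}
    (hU : Bornology.IsBounded U) : ∃ t₀ : ℝ, 0 < t₀ ∧ ∀ t ∈ Set.Icc (0 : ℝ) t₀, ∀ z ∈ U,
      IsUnit (Aop ((t : ℂ) • bivectorField S F W z)) := by
  set Φ := Module.End.toContinuousLinearMap (𝕜 := ℂ) (GT n)
  obtain ⟨C, hC⟩ := hU.isCompact_closure.exists_bound_of_continuousOn
    (f := fun z => 1 - Φ (Aop (bivectorField S F W z)))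
    (continuous_const.sub (contDiff_Aop hF).continuous).continuousOn
  refine ⟨(|C| + 1)⁻¹, by positivity, fun t ht z hz => ?_⟩
  have hN : Aop ((t : ℂ) • bivectorField S F W z) =
      1 - (t : ℂ) • (1 - Aop (bivectorField S F W z)) := by
    rw [Aop_ofReal_smul, Aop]
    module
  have h1 : IsUnit (Φ (Aop ((t : ℂ) • bivectorField S F W z))) := by
    rw [hN, map_sub, map_one, map_smul, map_sub, map_one]
    refine isUnit_one_sub_of_norm_lt_one ?_
    rw [norm_smul, Complex.norm_real, Real.norm_of_nonneg ht.1]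
    calc t * ‖1 - Φ (Aop (bivectorField S F W z))‖ ≤ (|C| + 1)⁻¹ * |C| := by
          gcongr
          · exact ht.2
          · exact (hC z (subset_closure hz)).trans (le_abs_self C)
      _ < 1 := by
        rw [inv_mul_lt_iff₀ (by positivity)]
        linarith
  exact (MulEquiv.isUnit_map Φ).1 h1

/-- A deformation compatible with `J_ω` gives a generalized Kähler structure when `A_{tε}` stays
invertible for `0 ≤ t ≤ 1`. -/
theorem IsDeformationOn.isGenKahlerOn (hW : ∀ a ∈ S, IsBivectorIn I (W a))
    (hc : ∀ a ∈ S, ∀ w, Jomega n (W a w) = W a (Jomega n w)) {U : Set (Fin n → ℂ)}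
    {J : (Fin n → ℂ) → Module.End ℂ (GT n)} (hJ : IsDeformationOn U (bivectorField S F W) J) :
    (∀ z ∈ U, Jomega n * J z = J z * Jomega n) ∧
      ((∀ z ∈ U, ∀ t ∈ Set.Icc (0 : ℝ) 1, IsUnit (Aop ((t : ℂ) • bivectorField S F W z))) →
        IsGenKahlerOn U (fun _ => Jomega n) J) := by
  have hbiv := isBivector_bivectorField (F := F) hW
  have hcomm : ∀ z w, Jomega n (bivectorField S F W z w) = bivectorField S F W z (Jomega n w) := by
    intro z w
    simp only [bivectorField, LinearMap.sum_apply, LinearMap.smul_apply, map_sum, map_smul]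
    exact Finset.sum_congr rfl fun a ha => by rw [hc a ha]
  have h1 : ∀ z ∈ U, Jomega n * J z = J z * Jomega n := fun z hz =>
    (hJ.1.pointwise z hz).commute_of_mapsTo_eigen isGenComplexVec_Jomega.real fun w hw => by
      rw [hJ.2 z hz] at hw ⊢
      exact Jomega_mem_deformed (hcomm z) hw
  refine ⟨h1, fun hu => ⟨⟨fun w => contDiffOn_const, fun z _ => isGenComplexVec_Jomega,
    isGenComplexVec_Jomega.courantClosedOn U⟩, hJ.1, h1, fun z hz => ?_⟩⟩
  have hu1 : IsUnit (Aop (bivectorField S F W z)) := by simpa using hu z hz 1 (by simp)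
  have : J z = Jdef (bivectorField S F W z) :=
    (hJ.1.pointwise z hz).eq_of_eigen_eq ((hbiv z).isGenComplexVec_Jdef hu1)
      ((hJ.2 z hz).trans ((hbiv z).eigen_Jdef hu1).symm)
  rw [this]
  exact (hbiv z).isPosMetric (hcomm z) (hu z hz)

end Field

/-! ### The two families of two-vectors -/

theorem wedge_apply (a b Y : GT n) : wedge a b Y = pair a Y • b - pair b Y • a := rfl

theorem isBivector_wedge {a b : GT n} (ha : Jcplx n a = -(Complex.I • a))
    (hb : Jcplx n b = -(Complex.I • b)) : IsBivector (wedge a b) where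
  skew v w := by
    simp only [wedge_apply, pair_sub_left, pair_smul_left, pair_comm v]
    ring
  left w := by
    simp only [wedge_apply, map_sub, map_smul, ha, hb]
    module
  right w := by
    have h : ∀ {a : GT n}, Jcplx n a = -(Complex.I • a) →
        pair a (Jcplx n w) = Complex.I * pair a w := fun {a} ha => by
      rw [← neg_eq_iff_eq_neg.2 (isGenComplexVec_Jcplx.pair_map_left a w), ha, pair_neg_left,
        pair_smul_left, neg_neg]
    simp only [wedge_apply, h ha, h hb]
    module

/-- `J_ω` exchanges `a ∧ b` with `J_ω a ∧ J_ω b`, so it commutes with their sum. -/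
theorem Jomega_wedge_add {a b a' b' : GT n} (ha : Jomega n a = -a') (hb : Jomega n b = -b')
    (w : GT n) :
    Jomega n ((wedge a b + wedge a' b') w) = (wedge a b + wedge a' b') (Jomega n w) := by
  have ha' : Jomega n a' = a := by
    rw [← neg_neg a', ← ha, map_neg, isGenComplexVec_Jomega.sq, neg_neg]
  have hb' : Jomega n b' = b := by
    rw [← neg_neg b', ← hb, map_neg, isGenComplexVec_Jomega.sq, neg_neg]
  have h : ∀ v : GT n, pair v (Jomega n w) = -pair (Jomega n v) w := fun v => by
    rw [isGenComplexVec_Jomega.pair_map_left, neg_neg]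
  simp only [LinearMap.add_apply, wedge_apply, map_add, map_sub, map_smul, h, ha, hb, ha', hb',
    pair_neg_left]
  module

theorem Jcplx_dZ (i : Fin n) : Jcplx n (dZ i) = -(Complex.I • dZ i) := by
  ext (k | k) <;> simp [Jcplx, dZ]

theorem Jcplx_dzbar (i : Fin n) : Jcplx n (dzbar i) = -(Complex.I • dzbar i) := by
  ext (k | k) <;> simp [Jcplx, dzbar]

theorem iotaOmega_eq (i : Fin n) : iotaOmega i = (Complex.I / 2) • dzbar i := by
  ext (k | k) <;> simp [iotaOmega, dzbar, dZ, omega, Pi.single_apply]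

theorem Jomega_dZ (i : Fin n) : Jomega n (dZ i) = -iotaOmega i := by
  ext k <;> simp [Jomega, iotaOmega, dZ]

theorem wedge_smul_smul (c : ℂ) (a b : GT n) : wedge (c • a) (c • b) = (c * c) • wedge a b := by
  refine LinearMap.ext fun w => ?_
  simp only [wedge_apply, LinearMap.smul_apply, pair_smul_left]
  module

theorem isBivectorIn_wedge_add {I : Finset (Fin n)} {i j : Fin n} (hi : i ∈ I) (hj : j ∈ I)
    (c : ℂ) :
    IsBivectorIn I (wedge (dZ i) (dZ j) + c • wedge (dzbar i) (dzbar j)) where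
  toIsBivector := (isBivector_wedge (Jcplx_dZ i) (Jcplx_dZ j)).add
    ((isBivector_wedge (Jcplx_dzbar i) (Jcplx_dzbar j)).smul c)
  fst_inl w k hk := by
    have h : ∀ i ∈ I, k ≠ i := fun i hi h => hk (h ▸ hi)
    simp [wedge_apply, dZ, dzbar, h i hi, h j hj]
  apply_covector g hg := by
    simp [wedge_apply, pair, ev, dZ, dzbar, hg i hi, hg j hj, Pi.single_apply]

theorem sum_eq_bivectorField (I : Finset (Fin n)) (F : Fin n → Fin n → (Fin n → ℂ) → ℂ)
    (V W : Fin n → Fin n → Module.End ℂ (GT n)) (z : Fin n → ℂ) :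
    ∑ i ∈ I, ∑ j ∈ I, F i j z • V i j + ∑ i ∈ I, ∑ j ∈ I, F i j z • W i j =
      bivectorField (I ×ˢ I) (fun a => F a.1 a.2) (fun a => V a.1 a.2 + W a.1 a.2) z := by
  simp only [bivectorField, Finset.sum_product, smul_add, Finset.sum_add_distrib]

theorem epsStd_eq (I : Finset (Fin n)) (F : Fin n → Fin n → (Fin n → ℂ) → ℂ) :
    epsStd I F = bivectorField (I ×ˢ I) (fun a => F a.1 a.2)
      (fun a => wedge (dZ a.1) (dZ a.2) + wedge (dzbar a.1) (dzbar a.2)) :=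
  funext fun z => sum_eq_bivectorField I F _ (fun i j => wedge (dzbar i) (dzbar j)) z

theorem epsOmega_eq (I : Finset (Fin n)) (F : Fin n → Fin n → (Fin n → ℂ) → ℂ) :
    epsOmega I F = bivectorField (I ×ˢ I) (fun a => F a.1 a.2)
      (fun a => wedge (dZ a.1) (dZ a.2) + wedge (iotaOmega a.1) (iotaOmega a.2)) :=
  funext fun z => sum_eq_bivectorField I F _ (fun i j => wedge (iotaOmega i) (iotaOmega j)) z

theorem isBivectorIn_std {I : Finset (Fin n)} {a : Fin n × Fin n} (ha : a ∈ I ×ˢ I) :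
    IsBivectorIn I (wedge (dZ a.1) (dZ a.2) + wedge (dzbar a.1) (dzbar a.2)) := by
  rw [Finset.mem_product] at ha
  simpa using isBivectorIn_wedge_add ha.1 ha.2 1

theorem isBivectorIn_omega {I : Finset (Fin n)} {a : Fin n × Fin n} (ha : a ∈ I ×ˢ I) :
    IsBivectorIn I (wedge (dZ a.1) (dZ a.2) + wedge (iotaOmega a.1) (iotaOmega a.2)) := by
  rw [Finset.mem_product] at ha
  rw [iotaOmega_eq, iotaOmega_eq, wedge_smul_smul]
  exact isBivectorIn_wedge_add ha.1 ha.2 _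

theorem smul_bivectorField {ι : Type*} (c : ℂ) (S : Finset ι) (F : ι → (Fin n → ℂ) → ℂ)
    (W : ι → Module.End ℂ (GT n)) (z : Fin n → ℂ) :
    c • bivectorField S F W z = bivectorField S (fun a p => c * F a p) W z := by
  simp only [bivectorField, Finset.smul_sum, smul_smul]

theorem pd_const_mul (A : Idx n) (c : ℂ) {f : (Fin n → ℂ) → ℂ} (hf : Differentiable ℂ f)
    (z : Fin n → ℂ) : pd A (fun p => c * f p) z = c * pd A f z := by
  rw [pd_eq_vpd, vpd_mul A (differentiableAt_const c) ((hf z).restrictScalars ℝ), vpd_const,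
    zero_mul, zero_add, pd_eq_vpd]

end GenKahler

end

theorem mainTheorem6 {n : ℕ} (I : Finset (Fin n)) (F : Fin n → Fin n → (Fin n → ℂ) → ℂ)
    (hol : ∀ i ∈ I, ∀ j ∈ I, Differentiable ℂ (F i j))
    (hd : ∀ i ∈ I, ∀ j ∈ I, ∀ k ∈ I, ∀ z, GenKahler.pd (Sum.inl k) (F i j) z = 0) :
    -- closedness, and the resulting generalized complex structure where `A_ε` is invertible
    (∀ ε : (Fin n → ℂ) → Module.End ℂ (GenKahler.GT n),
      ε = GenKahler.epsStd I F ∨ ε = GenKahler.epsOmega I F →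
      GenKahler.CourantClosedOn Set.univ (GenKahler.deformed ε) ∧
      ∀ U : Set (Fin n → ℂ), IsOpen U → (∀ z ∈ U, IsUnit (GenKahler.Aop (ε z))) →
        ∃ J : (Fin n → ℂ) → Module.End ℂ (GenKahler.GT n), GenKahler.IsDeformationOn U ε J ∧
          ∀ z ∈ U, ∀ J' : Module.End ℂ (GenKahler.GT n), GenKahler.IsGenComplexVec J' →
            GenKahler.eigen J' = GenKahler.deformed ε z → J' = J z) ∧
    -- the pair `(J_ω, J_ε)`
    (∀ (U : Set (Fin n → ℂ)) (J : (Fin n → ℂ) → Module.End ℂ (GenKahler.GT n)), IsOpen U →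
      GenKahler.IsDeformationOn U (GenKahler.epsOmega I F) J →
      (∀ z ∈ U, GenKahler.Jomega n * J z = J z * GenKahler.Jomega n) ∧
      ((∀ z ∈ U, ∀ t ∈ Set.Icc (0 : ℝ) 1,
          IsUnit (GenKahler.Aop ((t : ℂ) • GenKahler.epsOmega I F z))) →
        GenKahler.IsGenKahlerOn U (fun _ => GenKahler.Jomega n) J)) ∧
    -- small multiples on bounded sets
    (∀ U : Set (Fin n → ℂ), IsOpen U → Bornology.IsBounded U →
      ∃ t₀ : ℝ, 0 < t₀ ∧ ∀ t ∈ Set.Ioc (0 : ℝ) t₀,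
        (∀ z ∈ U, IsUnit (GenKahler.Aop ((t : ℂ) • GenKahler.epsOmega I F z))) ∧
        ∃ J : (Fin n → ℂ) → Module.End ℂ (GenKahler.GT n),
          GenKahler.IsDeformationOn U (fun z => (t : ℂ) • GenKahler.epsOmega I F z) J ∧
          GenKahler.IsGenKahlerOn U (fun _ => GenKahler.Jomega n) J) := by
  have hol' : ∀ a ∈ I ×ˢ I, Differentiable ℂ (F a.1 a.2) := fun a ha =>
    hol a.1 (Finset.mem_product.1 ha).1 a.2 (Finset.mem_product.1 ha).2
  have hd' : ∀ a ∈ I ×ˢ I, ∀ k ∈ I, ∀ z, GenKahler.pd (Sum.inl k) (F a.1 a.2) z = 0 := fun a ha =>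
    hd a.1 (Finset.mem_product.1 ha).1 a.2 (Finset.mem_product.1 ha).2
  have hcomm : ∀ a ∈ I ×ˢ I, ∀ w, GenKahler.Jomega n
      ((GenKahler.wedge (GenKahler.dZ a.1) (GenKahler.dZ a.2)
        + GenKahler.wedge (GenKahler.iotaOmega a.1) (GenKahler.iotaOmega a.2)) w) = _ :=
    fun a _ w =>
    GenKahler.Jomega_wedge_add (GenKahler.Jomega_dZ a.1) (GenKahler.Jomega_dZ a.2) w
  refine ⟨fun ε hε => ?_, fun U J _ hJ => ?_, fun U _ hU => ?_⟩
  · obtain ⟨W, hW, rfl⟩ : ∃ W : Fin n × Fin n → Module.End ℂ (GenKahler.GT n),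
        (∀ a ∈ I ×ˢ I, GenKahler.IsBivectorIn I (W a)) ∧
          ε = GenKahler.bivectorField (I ×ˢ I) (fun a => F a.1 a.2) W := by
      rcases hε with rfl | rfl
      · exact ⟨_, fun a ha => GenKahler.isBivectorIn_std ha, GenKahler.epsStd_eq I F⟩
      · exact ⟨_, fun a ha => GenKahler.isBivectorIn_omega ha, GenKahler.epsOmega_eq I F⟩
    refine ⟨GenKahler.courantClosedOn_deformed hW hol' hd', fun U _ hu => ?_⟩
    have hJ := GenKahler.isDeformationOn_Jdef hW hol' hd' hu
    exact ⟨_, hJ, fun z hz J' hJ' h => hJ'.eq_of_eigen_eq (hJ.1.pointwise z hz)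
      (h.trans (hJ.2 z hz).symm)⟩
  · rw [GenKahler.epsOmega_eq] at hJ ⊢
    exact hJ.isGenKahlerOn (fun a ha => GenKahler.isBivectorIn_omega ha) hcomm
  · rw [GenKahler.epsOmega_eq]
    obtain ⟨t₀, ht₀, hu⟩ := GenKahler.isUnit_Aop_of_bounded (W := fun a : Fin n × Fin n =>
      GenKahler.wedge (GenKahler.dZ a.1) (GenKahler.dZ a.2)
        + GenKahler.wedge (GenKahler.iotaOmega a.1) (GenKahler.iotaOmega a.2)) hol' hU
    refine ⟨t₀, ht₀, fun t ht => ⟨hu t ⟨ht.1.le, ht.2⟩, ?_⟩⟩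
    have hu1 := hu t ⟨ht.1.le, ht.2⟩
    -- `s (t ε)` for `s ∈ [0, 1]` is again a small multiple of `ε`
    have hu2 : ∀ z ∈ U, ∀ s ∈ Set.Icc (0 : ℝ) 1, IsUnit (GenKahler.Aop ((s : ℂ) • (t : ℂ) •
        GenKahler.bivectorField (I ×ˢ I) (fun a => F a.1 a.2) (fun a : Fin n × Fin n =>
          GenKahler.wedge (GenKahler.dZ a.1) (GenKahler.dZ a.2)
            + GenKahler.wedge (GenKahler.iotaOmega a.1) (GenKahler.iotaOmega a.2)) z)) := by
      intro z hz s hs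
      have := hu (s * t) ⟨mul_nonneg hs.1 ht.1.le,
        (mul_le_of_le_one_left ht.1.le hs.2).trans ht.2⟩ z hz
      rwa [Complex.ofReal_mul, mul_smul] at this
    simp only [GenKahler.smul_bivectorField (t : ℂ)] at hu1 hu2 ⊢
    have hJ := GenKahler.isDeformationOn_Jdef
      (fun a ha => GenKahler.isBivectorIn_omega (I := I) ha)
      (fun a ha => (hol' a ha).const_mul (t : ℂ))
      (fun a ha k hk z => by
        rw [GenKahler.pd_const_mul _ _ (hol' a ha), hd' a ha k hk, mul_zero]) hu1
    exact ⟨_, hJ, (hJ.isGenKahlerOn (fun a ha => GenKahler.isBivectorIn_omega ha) hcomm).2 hu2⟩
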